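/- A \emph{simple orthogonal polygon} with $n$ vertices is a closed bounded region $P\subset\mathbb R^2$ (boundary included, no holes) bounded by a simple closed polygonal chain with $n\ge 4$ vertices whose edges are alternately horizontal and vertical. Two points $p,q\in P$ are \emph{r-visible} to each other if the closed axis-parallel rectangle with opposite corners $p$ and $q$ (which may be degenerate) is contained in $P$. A \emph{conflict-free r-guarding} of $P$ with $t$ colors is a finite set $G\subset P$ such that every point of $P$ is r-visible from some $g\in G$, together with a coloring $\gamma\colon G\to\{1,\dots,t\}$ such that for every $p\in P$ there is a guard $g\in G$ r-visible from $p$ whose color $\gamma(g)$ differs from the colors of all other guards in $G$ that are r-visible from $p$. Let $\chi^r_{cf}(P)$ be the minimal $t$ for which $P$ has a conflict-free r-guarding with $t$ colors. \textbf{Theorem.} There is an absolute constant $C$ such that for every $n$ and every simple orthogonal polygon $P$ with $n$ vertices, $$\chi^r_{cf}(P)\le C\,\log\log n .$$ In other words, every simple orthogonal polygon with $n$ vertices has a conflict-free r-guarding with $O(\log\log n)$ colors. -/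

import Mathlib

/-- A simple orthogonal polygon with `n` vertices: a closed polygonal chain
`vertex 0, vertex 1, …, vertex (n - 1), vertex 0` without self-intersections, whose edges are
alternately horizontal and vertical, together with the closed bounded plane region that it
encloses. The region is the set that is compact, is the closure of its interior, and has the chain
as its topological boundary. -/
structure SimpleOrthogonalPolygon (n : ℕ) where
  /-- The vertices in cyclic order. -/
  vertex : ZMod n → ℝ × ℝ
  /-- The closed region bounded by the chain. -/
  region : Set (ℝ × ℝ)
  four_le : 4 ≤ n
  vertex_injective : Function.Injective vertex
  /-- Horizontal and vertical edges alternate. -/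
  alternating : ∀ i : ZMod n,
    ((vertex i).2 = (vertex (i + 1)).2 ∧ (vertex (i + 1)).1 = (vertex (i + 2)).1) ∨
    ((vertex i).1 = (vertex (i + 1)).1 ∧ (vertex (i + 1)).2 = (vertex (i + 2)).2)
  /-- Two different edges meet at most in a common end point. -/
  simple : ∀ i j : ZMod n, i ≠ j →
    segment ℝ (vertex i) (vertex (i + 1)) ∩ segment ℝ (vertex j) (vertex (j + 1)) ⊆
      {vertex i, vertex (i + 1)} ∩ {vertex j, vertex (j + 1)}
  isCompact_region : IsCompact region
  closure_interior_region : closure (interior region) = region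
  frontier_region : frontier region = ⋃ i : ZMod n, segment ℝ (vertex i) (vertex (i + 1))

/-- The r-visibility region of the point `p` in `P`: the points `q` of `P` such that the closed
axis-parallel rectangle spanned by `p` and `q` (here `Set.uIcc p q`) is contained in `P`. -/
def rVisibilityRegion (P : Set (ℝ × ℝ)) (p : ℝ × ℝ) : Set (ℝ × ℝ) :=
  {q | q ∈ P ∧ Set.uIcc p q ⊆ P}

/-- A finite set of points of `P` whose r-visibility regions jointly cover `P`. -/
def IsRGuardSet (P : Set (ℝ × ℝ)) (G : Finset (ℝ × ℝ)) : Prop :=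
  (∀ g ∈ G, g ∈ P) ∧ (⋃ g ∈ G, rVisibilityRegion P g) = P

/-- A conflict-free r-guarding of `P` with `t` colors: an r-guard set `G` whose guards are colored
by `γ` so that, for each `p` in `P`, among the guards in `G` that `p` sees
there is one whose color is not shared by any other of them. -/
def IsConflictFreeRGuarding (P : Set (ℝ × ℝ)) {t : ℕ} (G : Finset (ℝ × ℝ))
    (γ : {g // g ∈ G} → Fin t) : Prop :=
  IsRGuardSet P G ∧
    ∀ p ∈ P, ∃ g : {g // g ∈ G}, g.1 ∈ rVisibilityRegion P p ∧
      ∀ g' : {g // g ∈ G}, g'.1 ∈ rVisibilityRegion P p → γ g' = γ g → g' = g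

/-- The minimal number `t` of colors for which `P` has a conflict-free r-guarding with `t` colors
(the value is `⊤` if there is no such `t`). -/
noncomputable def cfRChromaticNumber (P : Set (ℝ × ℝ)) : ℕ∞ :=
  ⨅ (t : ℕ) (_ : ∃ (G : Finset (ℝ × ℝ)) (γ : {g // g ∈ G} → Fin t),
    IsConflictFreeRGuarding P G γ), (t : ℕ∞)

/-!
The vertex coordinates cut the plane into open rectangles, open segments and points. Such a cell is
contained in the polygon or disjoint from it, and two points see each other exactly when the
combinatorial box of cells between their cells lies in the polygon
(`uIcc_subset_iff_boxVisible`). So degenerate positions need no separate treatment, and the problem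
becomes one about a finite set `S` of lattice cells, of size at most quadratic in `n`. The only
property of `S` that matters is that its complement is connected (`CoConnected`).

*Connected complement.* The frontier of the polygon is connected, and simplicity of the chain
together with regularity of the region makes the exterior connected near each frontier point. This
implies that the exterior is connected (`isPreconnected_of_frontier`), so no instance of the Jordan
curve theorem is needed. Discretely it follows that the crossings of a closed lattice walk in `S`
with a ray from outside `S` cancel, and hence that the contact of two vertical runs in adjacent
columns is a bridge (`CoConnected.hasPotential_contact`).

*Decomposition into histograms.* A breadth-first search that alternates between vertical and
horizontal runs, from one root run per component, gives each cell a level. The row of a cell of odd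
level `2 * j + 1` leads to a cell of level at most `2 * j`, its gate, to the right or to the left.
By the bridge property the column of the gate depends only on the vertical run of the cell
(`GateRight.crosses` and its corollaries). So the cells of odd level with gate on the right split
into histograms, and cells of different histograms do not see each other. The cells with gate on the
left and those of even level are treated by symmetry. The four kinds of cells and the roots get
separate palettes, so it remains to guard histograms.

*One histogram.* The vertical runs form a forest, with the next column towards the gate as the
parent. Take a heavy path decomposition, and for each heavy path place one guard in the column of
its head, on a row that passes through all its nodes. A cell sees exactly the guards of its own
heavy path and of the heavy paths whose heads lie further out on its row. Their light depths are the
integers of an interval, without repetition, and they are at most the binary logarithm of the number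
of cells. The ruler sequence has a unique maximum on each interval, so coloring each guard by the
ruler sequence of its light depth is conflict-free, and the number of colors is logarithmic in the
largest light depth (`exists_conflictFree_rightCells`).
-/

open Relation Topology

/-! ### The ruler sequence -/

/-- The ruler sequence: the exponent of two in `m + 1`. -/
def rulerColor (m : ℕ) : ℕ := padicValNat 2 (m + 1)

theorem rulerColor_le_log {m k : ℕ} (h : m ≤ k) : rulerColor m ≤ Nat.log 2 (k + 1) :=
  (padicValNat_le_nat_log _).trans (Nat.log_mono_right (by omega))

/-- Between two numbers with the same exponent of two there is one with a larger exponent. -/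
theorem exists_rulerColor_lt {m₁ m₂ : ℕ} (h : m₁ < m₂) (he : rulerColor m₁ = rulerColor m₂) :
    ∃ m, m₁ < m ∧ m < m₂ ∧ rulerColor m₁ < rulerColor m := by
  unfold rulerColor at *
  obtain ⟨c, hc⟩ : 2 ^ padicValNat 2 (m₁ + 1) ∣ m₁ + 1 := pow_padicValNat_dvd
  obtain ⟨d, hd⟩ : 2 ^ padicValNat 2 (m₂ + 1) ∣ m₂ + 1 := pow_padicValNat_dvd
  have hc' : ¬ 2 ^ (padicValNat 2 (m₁ + 1) + 1) ∣ m₁ + 1 :=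
    pow_succ_padicValNat_not_dvd (by omega)
  have hd' : ¬ 2 ^ (padicValNat 2 (m₂ + 1) + 1) ∣ m₂ + 1 :=
    pow_succ_padicValNat_not_dvd (by omega)
  rw [← he] at hd hd'
  set e := padicValNat 2 (m₁ + 1)
  have hpos : 0 < 2 ^ e := by positivity
  have hcodd : c % 2 = 1 := by
    by_contra hcon
    apply hc'
    obtain ⟨k, rfl⟩ : 2 ∣ c := by omega
    exact ⟨k, by rw [hc, pow_succ]; ring⟩
  have hdodd : d % 2 = 1 := by
    by_contra hcon
    apply hd'
    obtain ⟨k, rfl⟩ : 2 ∣ d := by omega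
    exact ⟨k, by rw [hd, pow_succ]; ring⟩
  have hcd : c < d := by
    have : 2 ^ e * c < 2 ^ e * d := by omega
    exact lt_of_mul_lt_mul_left this (by omega)
  have h1 : 2 ^ e * c < 2 ^ e * (c + 1) := by nlinarith
  have h2 : 2 ^ e * (c + 1) < 2 ^ e * d := by
    apply Nat.mul_lt_mul_of_pos_left _ hpos
    omega
  refine ⟨2 ^ e * (c + 1) - 1, by omega, by omega, ?_⟩
  have h3 : 2 ^ e * (c + 1) - 1 + 1 = 2 ^ e * (c + 1) := by omega
  rw [h3]
  have : 2 ^ (e + 1) ∣ 2 ^ e * (c + 1) := by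
    obtain ⟨k, hk⟩ : 2 ∣ c + 1 := by omega
    exact ⟨k, by rw [hk, pow_succ]; ring⟩
  exact (padicValNat_dvd_iff_le (p := 2) (by positivity)).1 this

/-- The ruler sequence is a conflict-free coloring of the intervals of `ℕ`. -/
theorem exists_unique_rulerColor {a b : ℕ} (h : a ≤ b) :
    ∃ m, a ≤ m ∧ m ≤ b ∧ ∀ m', a ≤ m' → m' ≤ b → rulerColor m' = rulerColor m → m' = m := by
  obtain ⟨m, hm, hmax⟩ := Finset.exists_max_image (Finset.Icc a b) rulerColor
    ⟨a, Finset.mem_Icc.2 ⟨le_rfl, h⟩⟩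
  rw [Finset.mem_Icc] at hm
  refine ⟨m, hm.1, hm.2, fun m' h1 h2 h3 => ?_⟩
  by_contra hne
  rcases lt_or_gt_of_ne hne with hlt | hlt
  · obtain ⟨k, hk1, hk2, hk3⟩ := exists_rulerColor_lt hlt h3
    have := hmax k (Finset.mem_Icc.2 ⟨by omega, by omega⟩)
    omega
  · obtain ⟨k, hk1, hk2, hk3⟩ := exists_rulerColor_lt hlt h3.symm
    have := hmax k (Finset.mem_Icc.2 ⟨by omega, by omega⟩)
    omega

/-! ### Heavy path decomposition -/

section Forest

variable {V : Type*} {R H : V → V → Prop}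

/-- Two ancestors of the same node are comparable. -/
theorem ReflTransGen.comparable (hR : ∀ c u u', R c u → R c u' → u = u') {w u u' : V}
    (h : ReflTransGen R w u) (h' : ReflTransGen R w u') :
    ReflTransGen R u u' ∨ ReflTransGen R u' u := by
  induction h with
  | refl => exact Or.inl h'
  | tail hab hbc ih =>
    rcases ih with ih | ih
    · rcases ReflTransGen.cases_head ih with rfl | ⟨d, hd, hd'⟩
      · exact Or.inr (ReflTransGen.single hbc)
      · obtain rfl := hR _ _ _ hbc hd
        exact Or.inl hd'
    · exact Or.inr (ih.tail hbc)

theorem ReflTransGen.rank_le {rk : V → ℤ} (hrk : ∀ c u, R c u → rk u = rk c + 1) {w u : V}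
    (h : ReflTransGen R w u) : rk w ≤ rk u := by
  induction h with
  | refl => exact le_rfl
  | tail _ hbc ih => have := hrk _ _ hbc; omega

theorem ReflTransGen.eq_of_rank {rk : V → ℤ} (hrk : ∀ c u, R c u → rk u = rk c + 1) {w u : V}
    (h : ReflTransGen R w u) (he : rk w = rk u) : w = u := by
  rcases ReflTransGen.cases_head h with rfl | ⟨d, hd, hd'⟩
  · rfl
  · have := hrk _ _ hd
    have := ReflTransGen.rank_le hrk hd'
    omega

/-- A node between the two ends of a chain of a subrelation lies on that chain. -/
theorem ReflTransGen.split_sub (hR : ∀ c u u', R c u → R c u' → u = u') {rk : V → ℤ}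
    (hrk : ∀ c u, R c u → rk u = rk c + 1) (hHR : ∀ c u, H c u → R c u) {w v u : V}
    (h : ReflTransGen H w u) (h1 : ReflTransGen R w v) (h2 : ReflTransGen R v u) :
    ReflTransGen H w v ∧ ReflTransGen H v u := by
  induction h using ReflTransGen.head_induction_on with
  | refl =>
    have := ReflTransGen.rank_le hrk h1
    have := ReflTransGen.rank_le hrk h2
    obtain rfl := ReflTransGen.eq_of_rank hrk h1 (by omega)
    exact ⟨.refl, .refl⟩
  | head hab hbc ih =>
    rcases ReflTransGen.cases_head h1 with rfl | ⟨d, hd, hd'⟩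
    · exact ⟨.refl, hbc.head hab⟩
    · obtain rfl := hR _ _ _ (hHR _ _ hab) hd
      have := ih hd'
      exact ⟨this.1.head hab, this.2⟩

/-- Heavy path decomposition of a finite forest. The relation `R c u` says that `u` is the parent
of `c`, and `H` singles out one heavy child of each node that has children. The light depth `l`
grows along the other edges only, and it is at most logarithmic because a light child has at most
half the descendants of its parent. -/
theorem exists_heavy_path_decomposition [Finite V] (R : V → V → Prop)
    (hR : ∀ c u u', R c u → R c u' → u = u') (rk : V → ℤ)
    (hrk : ∀ c u, R c u → rk u = rk c + 1) :
    ∃ (H : V → V → Prop) (l : V → ℕ),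
      (∀ c u, H c u → R c u) ∧ (∀ c c' u, H c u → H c' u → c = c') ∧
      (∀ u, (∃ c, R c u) → ∃ c, H c u) ∧ (∀ c u, H c u → l c = l u) ∧
      (∀ c u, R c u → ¬ H c u → l c = l u + 1) ∧ ∀ u, 2 ^ l u ≤ Nat.card V := by
  classical
  have := Fintype.ofFinite V
  let size : V → ℕ := fun u => (Finset.univ.filter fun w => ReflTransGen R w u).card
  have hex : ∀ u, ∃ c, (∃ c, R c u) → R c u ∧ ∀ c', R c' u → size c' ≤ size c := by
    intro u
    by_cases h : ∃ c, R c u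
    · obtain ⟨c0, hc0⟩ := h
      obtain ⟨c, hc, hmax⟩ := Finset.exists_max_image (Finset.univ.filter fun c => R c u) size
        ⟨c0, by simpa using hc0⟩
      exact ⟨c, fun _ => ⟨by simpa using hc, fun c' hc' => hmax c' (by simpa using hc')⟩⟩
    · exact ⟨u, fun h' => (h h').elim⟩
  choose hv hhv using hex
  let H : V → V → Prop := fun c u => R c u ∧ c = hv u
  let light : V → Prop := fun w => ∃ u, R w u ∧ w ≠ hv u
  let anc : V → Finset V := fun u => Finset.univ.filter fun w => ReflTransGen R u w
  let l : V → ℕ := fun u => ((anc u).filter light).card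
  have hanc : ∀ c u, R c u → anc c = insert c (anc u) ∧ c ∉ anc u := by
    intro c u hcu
    refine ⟨?_, ?_⟩
    · ext w
      simp only [anc, Finset.mem_filter, Finset.mem_univ, true_and, Finset.mem_insert]
      constructor
      · intro h
        rcases ReflTransGen.cases_head h with rfl | ⟨d, hd, hd'⟩
        · exact Or.inl rfl
        · obtain rfl := hR _ _ _ hcu hd
          exact Or.inr hd'
      · rintro (rfl | h)
        · exact .refl
        · exact h.head hcu
    · simp only [anc, Finset.mem_filter, Finset.mem_univ, true_and]
      intro h
      have := ReflTransGen.rank_le hrk h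
      have := hrk _ _ hcu
      omega
  have hl1 : ∀ c u, R c u → ¬ light c → l c = l u := by
    intro c u hcu hh
    simp only [l]
    rw [(hanc c u hcu).1, Finset.filter_insert, if_neg hh]
  have hl2 : ∀ c u, R c u → light c → l c = l u + 1 := by
    intro c u hcu hh
    simp only [l]
    rw [(hanc c u hcu).1, Finset.filter_insert, if_pos hh, Finset.card_insert_of_notMem]
    intro hmem
    exact (hanc c u hcu).2 (Finset.mem_filter.1 hmem).1
  have hsub : ∀ c u, R c u → size c ≤ size u := by
    intro c u hcu
    apply Finset.card_le_card
    intro w hw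
    simp only [Finset.mem_filter, Finset.mem_univ, true_and] at hw ⊢
    exact hw.tail hcu
  have hlight : ∀ c u, R c u → c ≠ hv u → 2 * size c ≤ size u := by
    intro c u hcu hne
    have hh := hhv u ⟨c, hcu⟩
    have h1 := hh.2 c hcu
    -- The descendants of two different children of the same node are disjoint.
    have hdisj : Disjoint (Finset.univ.filter fun w => ReflTransGen R w c)
        (Finset.univ.filter fun w => ReflTransGen R w (hv u)) := by
      rw [Finset.disjoint_left]
      intro w hw hw'
      simp only [Finset.mem_filter, Finset.mem_univ, true_and] at hw hw'
      have e1 := hrk _ _ hcu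
      have e2 := hrk _ _ hh.1
      rcases ReflTransGen.comparable hR hw hw' with h | h
      · exact hne (ReflTransGen.eq_of_rank hrk h (by omega))
      · exact hne (ReflTransGen.eq_of_rank hrk h (by omega)).symm
    have : size c + size (hv u) ≤ size u := by
      simp only [size]
      rw [← Finset.card_union_of_disjoint hdisj]
      apply Finset.card_le_card
      intro w hw
      simp only [Finset.mem_union, Finset.mem_filter, Finset.mem_univ, true_and] at hw ⊢
      rcases hw with hw | hw
      · exact hw.tail hcu
      · exact hw.tail hh.1
    omega
  have key : ∀ N u, (anc u).card = N → 2 ^ l u * size u ≤ Nat.card V := by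
    intro N
    induction N with
    | zero =>
      intro u hu
      have : u ∈ anc u := by simp [anc, ReflTransGen.refl]
      rw [Finset.card_eq_zero] at hu
      simp [hu] at this
    | succ N ih =>
      intro u hu
      by_cases hp : ∃ w, R u w
      · obtain ⟨w, hw⟩ := hp
        have hN : (anc w).card = N := by
          rw [(hanc u w hw).1, Finset.card_insert_of_notMem (hanc u w hw).2] at hu
          omega
        have := ih w hN
        by_cases hh : u = hv w
        · rw [hl1 u w hw (by
            rintro ⟨w', hw', hne⟩
            obtain rfl := hR _ _ _ hw hw'
            exact hne hh)]
          exact (Nat.mul_le_mul_left _ (hsub u w hw)).trans this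
        · rw [hl2 u w hw ⟨w, hw, hh⟩, pow_succ, mul_assoc]
          exact (Nat.mul_le_mul_left _ (hlight u w hw hh)).trans this
      · have : l u = 0 := by
          simp only [l, Finset.card_eq_zero]
          ext w
          simp only [anc, Finset.mem_filter, Finset.mem_univ, true_and, Finset.notMem_empty,
            iff_false, not_and]
          intro h
          rcases ReflTransGen.cases_head h with rfl | ⟨d, hd, -⟩
          · rintro ⟨d, hd, -⟩
            exact hp ⟨d, hd⟩
          · exact (hp ⟨d, hd⟩).elim
        rw [this, pow_zero, one_mul, Nat.card_eq_fintype_card]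
        exact Finset.card_le_univ _
  refine ⟨H, l, fun c u h => h.1, fun c c' u h h' => h.2.trans h'.2.symm, ?_, ?_, ?_, ?_⟩
  · intro u hu
    exact ⟨hv u, (hhv u hu).1, rfl⟩
  · rintro c u ⟨hcu, hh⟩
    apply hl1 c u hcu
    rintro ⟨w', hw', hne⟩
    obtain rfl := hR _ _ _ hcu hw'
    exact hne hh
  · intro c u hcu hh
    exact hl2 c u hcu ⟨u, hcu, fun h => hh ⟨hcu, h⟩⟩
  · intro u
    refine le_trans ?_ (key _ u rfl)
    apply Nat.le_mul_of_pos_right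
    apply Finset.card_pos.2
    exact ⟨u, by simp [ReflTransGen.refl]⟩

theorem exists_leaf [Finite V] {rk : V → ℤ} (hrk : ∀ c u, R c u → rk c < rk u) (u : V) :
    ∃ w, ReflTransGen R w u ∧ ∀ c, ¬ R c w := by
  have := Fintype.ofFinite V
  obtain ⟨b, -, hb⟩ := Finset.exists_min_image (Finset.univ : Finset V) rk ⟨u, Finset.mem_univ _⟩
  have key : ∀ N : ℕ, ∀ u, rk u ≤ rk b + N → ∃ w, ReflTransGen R w u ∧ ∀ c, ¬ R c w := by
    intro N
    induction N with
    | zero =>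
      intro u hu
      refine ⟨u, .refl, fun c hc => ?_⟩
      have := hb c (Finset.mem_univ _)
      have := hrk _ _ hc
      push_cast at hu
      omega
    | succ N ih =>
      intro u hu
      by_cases h : ∃ c, R c u
      · obtain ⟨c, hc⟩ := h
        have := hrk _ _ hc
        obtain ⟨w, hw, hw'⟩ := ih c (by push_cast at hu; omega)
        exact ⟨w, hw.tail hc, hw'⟩
      · exact ⟨u, .refl, fun c hc => h ⟨c, hc⟩⟩
  have := hb u (Finset.mem_univ _)
  exact key (rk u - rk b).toNat u (by omega)

theorem exists_head [Finite V] {rk : V → ℤ} (hrk : ∀ c u, H c u → rk c < rk u) (v : V) :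
    ∃ u, ReflTransGen H v u ∧ ∀ w, ¬ H u w := by
  obtain ⟨w, hw, hw'⟩ := exists_leaf (R := fun a b => H b a) (rk := fun u => - rk u)
    (fun c u h => by have := hrk _ _ h; omega) v
  exact ⟨w, hw.swap, hw'⟩

section Depth

variable {l : V → ℕ} (hl : ∀ c u, H c u → l c = l u)
  (hl' : ∀ c u, R c u → ¬ H c u → l c = l u + 1)

theorem lightDepth_eq (hl : ∀ c u, H c u → l c = l u) {w u : V} (h : ReflTransGen H w u) :
    l w = l u := by
  induction h with
  | refl => rfl
  | tail _ hbc ih => rw [ih, hl _ _ hbc]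

include hl hl' in
theorem lightDepth_le {w u : V} (h : ReflTransGen R w u) : l u ≤ l w := by
  induction h with
  | refl => rfl
  | @tail b c _ hbc ih =>
    by_cases hh : H b c
    · have := hl _ _ hh; omega
    · have := hl' _ _ hbc hh; omega

include hl hl' in
theorem lightDepth_lt_of_head {w u : V} (h : ReflTransGen R w u) (hne : w ≠ u)
    (hw : ∀ d, ¬ H w d) : l u < l w := by
  rcases ReflTransGen.cases_head h with rfl | ⟨d, hd, hd'⟩
  · exact (hne rfl).elim
  · have := hl' _ _ hd (hw d)
    have := lightDepth_le hl hl' hd'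
    omega

include hl hl' in
/-- The light depth takes every intermediate value at the head of a heavy path. -/
theorem exists_head_of_lightDepth (hR : ∀ c u u', R c u → R c u' → u = u')
    (hHR : ∀ c u, H c u → R c u) {w v : V} (h : ReflTransGen R w v) {m : ℕ} (hm : l v < m)
    (hm' : m ≤ l w) :
    ∃ u, (∀ d, ¬ H u d) ∧ l u = m ∧ ReflTransGen R w u ∧ ReflTransGen R u v ∧ u ≠ v := by
  induction h with
  | refl => omega
  | @tail b c hwb hbc ih =>
    by_cases hlt : l b < m
    · obtain ⟨u, h1, h2, h3, h4, h5⟩ := ih hlt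
      refine ⟨u, h1, h2, h3, h4.tail hbc, ?_⟩
      rintro rfl
      omega
    · by_cases hh : H b c
      · have := hl _ _ hh; omega
      · have := hl' _ _ hbc hh
        refine ⟨b, fun d hd => hh ?_, by omega, hwb, .single hbc, ?_⟩
        · obtain rfl := hR _ _ _ hbc (hHR _ _ hd)
          exact hd
        · rintro rfl
          omega

end Depth

end Forest

/-! ### Lattice cells, box visibility and bridges -/

/-- Discrete rectangular visibility: all lattice cells of the box spanned by `p` and `q` are
in `S`. -/
def BoxVisible (S : Set (ℤ × ℤ)) (p q : ℤ × ℤ) : Prop :=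
  ∀ x y, min p.1 q.1 ≤ x → x ≤ max p.1 q.1 → min p.2 q.2 ≤ y → y ≤ max p.2 q.2 → (x, y) ∈ S

/-- The complement of the bounded cell set `S` is connected under sharing a side of cells, stated
as an induction principle: a property that is invariant under passing to a neighboring cell outside
`S`, and that holds outside a large box, holds at every cell outside `S`. -/
def CoConnected (S : Set (ℤ × ℤ)) : Prop :=
  ∃ B : ℤ, (∀ x y, (x, y) ∈ S → |x| < B ∧ |y| < B) ∧
    ∀ Q : ℤ → ℤ → Prop,
      (∀ a b, (a, b) ∉ S → (a, b + 1) ∉ S → (Q a b ↔ Q a (b + 1))) →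
      (∀ a b, (a, b) ∉ S → (a + 1, b) ∉ S → (Q a b ↔ Q (a + 1) b)) →
      (∀ a b, B ≤ |a| ∨ B ≤ |b| → Q a b) → ∀ a b, (a, b) ∉ S → Q a b

theorem CoConnected.swap {S : Set (ℤ × ℤ)} (h : CoConnected S) :
    CoConnected {p | (p.2, p.1) ∈ S} := by
  obtain ⟨B, hB, hQ⟩ := h
  refine ⟨B, fun x y hxy => (hB _ _ hxy).symm, fun Q h1 h2 h3 a b hab => ?_⟩
  exact hQ (fun a b => Q b a) (fun a b h h' => h2 _ _ h h') (fun a b h h' => h1 _ _ h h')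
    (fun a b h => h3 _ _ h.symm) b a hab

theorem CoConnected.neg {S : Set (ℤ × ℤ)} (h : CoConnected S) :
    CoConnected {p | (-p.1, p.2) ∈ S} := by
  obtain ⟨B, hB, hQ⟩ := h
  refine ⟨B, fun x y hxy => ?_, fun Q h1 h2 h3 a b hab => ?_⟩
  · have := hB _ _ hxy
    rwa [abs_neg] at this
  · have := hQ (fun a b => Q (-a) b) (fun a b h h' => h1 _ _ (by simpa using h) (by simpa using h'))
      (fun a b h h' => by
        have := h2 (-(a + 1)) b (by simpa using h') (by simpa using h)
        rw [show -(a + 1) + 1 = -a by ring] at this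
        exact this.symm)
      (fun a b h => h3 _ _ (by simpa using h)) (-a) b hab
    simpa using this

/-- The function `J`, read as a jump along each step to the right and zero along vertical steps,
is the difference of a potential on `S`. -/
def HasPotential (S : Set (ℤ × ℤ)) (J : ℤ → ℤ → ℤ) : Prop :=
  ∃ F : ℤ → ℤ → ℤ,
    (∀ x y, (x, y) ∈ S → (x, y + 1) ∈ S → F x (y + 1) = F x y) ∧
    ∀ x y, (x, y) ∈ S → (x + 1, y) ∈ S → F (x + 1) y = F x y + J x y

/-- Crossings of the ray above the cell `(a, b)`. -/
def rayJump (a b x y : ℤ) : ℤ := if x = a ∧ b < y then 1 else 0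

theorem HasPotential.congr {S : Set (ℤ × ℤ)} {J J' : ℤ → ℤ → ℤ} (h : HasPotential S J)
    (hJ : ∀ x y, (x, y) ∈ S → (x + 1, y) ∈ S → J x y = J' x y) : HasPotential S J' := by
  obtain ⟨F, h1, h2⟩ := h
  exact ⟨F, h1, fun x y hx hy => by rw [h2 x y hx hy, hJ x y hx hy]⟩

theorem HasPotential.sub {S : Set (ℤ × ℤ)} {J J' : ℤ → ℤ → ℤ} (h : HasPotential S J)
    (h' : HasPotential S J') : HasPotential S fun x y => J x y - J' x y := by
  obtain ⟨F, h1, h2⟩ := h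
  obtain ⟨F', h1', h2'⟩ := h'
  refine ⟨fun x y => F x y - F' x y, fun x y hx hy => ?_, fun x y hx hy => ?_⟩
  · simp only [h1 x y hx hy, h1' x y hx hy]
  · simp only [h2 x y hx hy, h2' x y hx hy]
    ring

/-- Moving the foot of a ray by one column, at a cell outside `S`, changes the crossing numbers by
the coboundary of the part of the new column above the foot. -/
theorem hasPotential_rayJump_succ {S : Set (ℤ × ℤ)} {a b : ℤ} (h : (a + 1, b) ∉ S) :
    HasPotential S fun x y => rayJump a b x y - rayJump (a + 1) b x y := by
  refine ⟨fun x y => if x = a + 1 ∧ b < y then 1 else 0, fun x y hx hy => ?_, fun x y hx hy => ?_⟩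
  · by_cases hxa : x = a + 1
    · subst hxa
      have : y ≠ b := by rintro rfl; exact h hx
      have : y + 1 ≠ b := by rintro rfl; exact h hy
      have : b < y + 1 ↔ b < y := by omega
      simp [this]
    · simp [hxa]
  · simp only [rayJump]
    split_ifs <;> omega

/-- The complement of `S` is connected, so no closed lattice walk in `S` winds around a cell
outside `S`: the crossings of a ray from such a cell have a potential. -/
theorem CoConnected.hasPotential_rayJump {S : Set (ℤ × ℤ)} (hS : CoConnected S) {a b : ℤ}
    (h : (a, b) ∉ S) : HasPotential S (rayJump a b) := by
  obtain ⟨B, hB, hQ⟩ := hS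
  refine hQ (fun a b => HasPotential S (rayJump a b)) ?_ ?_ ?_ a b h
  · intro a b h1 h2
    have key : ∀ x y, (x, y) ∈ S → rayJump a b x y = rayJump a (b + 1) x y := by
      intro x y hx
      have : ¬ (x = a ∧ y = b + 1) := by rintro ⟨rfl, rfl⟩; exact h2 hx
      simp only [rayJump]
      split_ifs <;> omega
    exact ⟨fun h => h.congr fun x y hx _ => key x y hx,
      fun h => h.congr fun x y hx _ => (key x y hx).symm⟩
  · intro a b h1 h2
    have key := hasPotential_rayJump_succ (a := a) (b := b) h2
    constructor
    · intro h
      exact (h.sub key).congr fun x y _ _ => by ring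
    · intro h
      have h0 : HasPotential S fun _ _ => 0 := ⟨fun _ _ => 0, by simp, by simp⟩
      exact (key.sub (h0.sub h)).congr fun x y _ _ => by ring
  · rintro a b (h | h)
    · refine ⟨fun _ _ => 0, by simp, fun x y hx hy => ?_⟩
      have : x ≠ a := by rintro rfl; have := (hB _ _ hx).1; omega
      simp [rayJump, this]
    · rcases le_abs.1 h with h | h
      · refine ⟨fun _ _ => 0, by simp, fun x y hx hy => ?_⟩
        have := (abs_lt.1 (hB _ _ hx).2).2
        have : ¬ b < y := by omega
        simp [rayJump, this]
      · refine ⟨fun x _ => if a + 1 ≤ x then 1 else 0, by simp, fun x y hx hy => ?_⟩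
        have := (abs_lt.1 (hB _ _ hx).2).1
        have : b < y := by omega
        simp only [rayJump]
        split_ifs <;> omega

theorem CoConnected.hasPotential_rayJump' {S : Set (ℤ × ℤ)} (hS : CoConnected S) {a b : ℤ}
    (h : (a, b) ∉ S ∨ (a + 1, b) ∉ S) : HasPotential S (rayJump a b) := by
  rcases h with h | h
  · exact hS.hasPotential_rayJump h
  · have key := hasPotential_rayJump_succ (a := a) (b := b) h
    have h0 : HasPotential S fun _ _ => 0 := ⟨fun _ _ => 0, by simp, by simp⟩
    exact (key.sub (h0.sub (hS.hasPotential_rayJump h))).congr fun x y _ _ => by ring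

open Classical in
/-- The contact between two vertical runs in adjacent columns is a bridge: cutting `S` along it
separates the two sides. -/
theorem CoConnected.hasPotential_contact {S : Set (ℤ × ℤ)} (hS : CoConnected S) {a y : ℤ}
    (h1 : (a, y) ∈ S) (h2 : (a + 1, y) ∈ S) :
    HasPotential S fun x y' => if x = a ∧ BoxVisible S (a, y) (a + 1, y') then 1 else 0 := by
  obtain ⟨B, hB, -⟩ := id hS
  -- `u` and `d` are the first heights above and below `y` where the two runs lose contact.
  have hu : ∃ n : ℕ, (a, y + n) ∉ S ∨ (a + 1, y + n) ∉ S := by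
    refine ⟨(B - y).toNat, Or.inl fun h => ?_⟩
    have := (abs_lt.1 (hB _ _ h).2).2
    omega
  have hd : ∃ n : ℕ, (a, y - n) ∉ S ∨ (a + 1, y - n) ∉ S := by
    refine ⟨(B + y).toNat, Or.inl fun h => ?_⟩
    have := (abs_lt.1 (hB _ _ h).2).1
    omega
  have hu1 := Nat.find_spec hu
  have hu2 := fun m (hm : m < Nat.find hu) => Nat.find_min hu hm
  have hd1 := Nat.find_spec hd
  have hd2 := fun m (hm : m < Nat.find hd) => Nat.find_min hd hm
  have hu0 : 0 < Nat.find hu := (Nat.find_pos hu).2 (by simp [h1, h2])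
  have hd0 : 0 < Nat.find hd := (Nat.find_pos hd).2 (by simp [h1, h2])
  generalize Nat.find hu = u at *
  generalize Nat.find hd = d at *
  have key := (hS.hasPotential_rayJump' hd1).sub (hS.hasPotential_rayJump' hu1)
  refine key.congr fun x y' hx hy => ?_
  by_cases hxa : x = a
  · subst hxa
    have e1 : y' ≠ y + u := by
      rintro rfl
      rcases hu1 with h | h
      · exact h hx
      · exact h hy
    have e2 : y' ≠ y - d := by
      rintro rfl
      rcases hd1 with h | h
      · exact h hx
      · exact h hy
    by_cases hin : y - d < y' ∧ y' < y + u
    · have : BoxVisible S (x, y) (x + 1, y') := by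
        intro x1 y1 h1 h2 h3 h4
        simp only at h1 h2 h3 h4
        have hb : (x, y1) ∈ S ∧ (x + 1, y1) ∈ S := by
          rcases le_total y y1 with hle | hle
          · have := hu2 (y1 - y).toNat (by omega)
            rw [show y + ((y1 - y).toNat : ℤ) = y1 by omega] at this
            tauto
          · have := hd2 (y - y1).toNat (by omega)
            rw [show y - ((y - y1).toNat : ℤ) = y1 by omega] at this
            tauto
        have : x1 = x ∨ x1 = x + 1 := by omega
        rcases this with rfl | rfl
        · exact hb.1
        · exact hb.2
      simp only [rayJump, this, and_self, if_true, true_and]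
      split_ifs <;> omega
    · have : ¬ BoxVisible S (x, y) (x + 1, y') := by
        intro hv
        by_cases hlt : y + u ≤ y'
        · rcases hu1 with h | h
          · exact h (hv _ _ (by simp) (by simp) (by simp) (by simp [hlt]))
          · exact h (hv _ _ (by simp) (by simp) (by simp) (by simp [hlt]))
        · have hlt : y' ≤ y - d := by omega
          rcases hd1 with h | h
          · exact h (hv _ _ (by simp) (by simp) (by simp [hlt]) (by simp))
          · exact h (hv _ _ (by simp) (by simp) (by simp [hlt]) (by simp))
      simp only [rayJump, this, and_false, if_false, true_and]
      split_ifs <;> omega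
  · simp [rayJump, hxa]

/-! ### Levels and gates -/

theorem BoxVisible.symm {S : Set (ℤ × ℤ)} {p q : ℤ × ℤ} (h : BoxVisible S p q) :
    BoxVisible S q p := by
  intro x y h1 h2 h3 h4
  exact h x y (by rwa [min_comm]) (by rwa [max_comm]) (by rwa [min_comm]) (by rwa [max_comm])

theorem BoxVisible.left_mem {S : Set (ℤ × ℤ)} {p q : ℤ × ℤ} (h : BoxVisible S p q) : p ∈ S :=
  h p.1 p.2 (by simp) (by simp) (by simp) (by simp)

theorem BoxVisible.right_mem {S : Set (ℤ × ℤ)} {p q : ℤ × ℤ} (h : BoxVisible S p q) : q ∈ S :=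
  h q.1 q.2 (by simp) (by simp) (by simp) (by simp)

theorem boxVisible_self {S : Set (ℤ × ℤ)} {p : ℤ × ℤ} (h : p ∈ S) : BoxVisible S p p := by
  intro a b h1 h2 h3 h4
  rw [min_self] at h1 h3
  rw [max_self] at h2 h4
  obtain rfl := le_antisymm h1 h2
  obtain rfl := le_antisymm h3 h4
  exact h

theorem BoxVisible.mono {S : Set (ℤ × ℤ)} {p q : ℤ × ℤ} (h : BoxVisible S p q) {a b c d : ℤ}
    (h1 : min p.1 q.1 ≤ min a c) (h2 : max a c ≤ max p.1 q.1)
    (h3 : min p.2 q.2 ≤ min b d) (h4 : max b d ≤ max p.2 q.2) : BoxVisible S (a, b) (c, d) := by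
  intro x y h5 h6 h7 h8
  exact h x y (h1.trans h5) (h6.trans h2) (h3.trans h7) (h8.trans h4)

theorem eq_of_forall_succ_eq {f : ℤ → ℤ} {a b : ℤ} (hab : a ≤ b)
    (h : ∀ i, a ≤ i → i < b → f (i + 1) = f i) : f b = f a := by
  induction b, hab using Int.leInduction with
  | base => rfl
  | succ b hb ih =>
    rw [h b hb (by omega)]
    exact ih fun i h1 h2 => h i h1 (by omega)

section Potential

variable {S : Set (ℤ × ℤ)} {F J : ℤ → ℤ → ℤ}

theorem potential_eq_vertical
    (hF : ∀ x y, (x, y) ∈ S → (x, y + 1) ∈ S → F x (y + 1) = F x y) {x y y' : ℤ}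
    (h : BoxVisible S (x, y) (x, y')) : F x y = F x y' := by
  wlog hle : y ≤ y' generalizing y y'
  · exact (this h.symm (by omega)).symm
  refine (eq_of_forall_succ_eq (f := F x) hle fun i h1 h2 => ?_).symm
  exact hF _ _ (h _ _ (by simp) (by simp) (by simp only; omega) (by simp only; omega))
    (h _ _ (by simp) (by simp) (by simp only; omega) (by simp only; omega))

theorem potential_eq_horizontal
    (hF : ∀ x y, (x, y) ∈ S → (x + 1, y) ∈ S → F (x + 1) y = F x y + J x y) {x x' y : ℤ}
    (h : BoxVisible S (x, y) (x', y))
    (hJ : ∀ i, min x x' ≤ i → i < max x x' → J i y = 0) : F x y = F x' y := by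
  wlog hle : x ≤ x' generalizing x x'
  · exact (this h.symm (by rwa [min_comm, max_comm]) (by omega)).symm
  refine (eq_of_forall_succ_eq (f := fun i => F i y) hle fun i h1 h2 => ?_).symm
  have := hF i y (h _ _ (by simp only; omega) (by simp only; omega) (by simp) (by simp))
    (h _ _ (by simp only; omega) (by simp only; omega) (by simp) (by simp))
  rw [hJ i (by omega) (by omega)] at this
  simpa using this

end Potential

/-- Levels of the cells of `S`, as they arise from a breadth-first search in the intersection graph
of the maximal vertical and horizontal runs. The cells of level at most `2 * j` form a union of
vertical runs, those of level at most `2 * j + 1` a union of horizontal runs, each cell of positive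
level is joined to a lower level along its run, and those of level zero are joined to the root `r`
of their component. -/
structure LevelFunction (S : Set (ℤ × ℤ)) (r : ℤ × ℤ → ℤ × ℤ) (lev : ℤ × ℤ → ℕ) : Prop where
  root_v : ∀ x y y', BoxVisible S (x, y) (x, y') → r (x, y) = r (x, y')
  root_h : ∀ x x' y, BoxVisible S (x, y) (x', y) → r (x, y) = r (x', y)
  even_v : ∀ j x y y', BoxVisible S (x, y) (x, y') → lev (x, y) ≤ 2 * j → lev (x, y') ≤ 2 * j
  odd_h : ∀ j x x' y, BoxVisible S (x, y) (x', y) → lev (x, y) ≤ 2 * j + 1 →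
    lev (x', y) ≤ 2 * j + 1
  odd_ex : ∀ j x y, (x, y) ∈ S → lev (x, y) = 2 * j + 1 →
    ∃ x', BoxVisible S (x, y) (x', y) ∧ lev (x', y) ≤ 2 * j
  even_ex : ∀ j x y, (x, y) ∈ S → lev (x, y) = 2 * j + 2 →
    ∃ y', BoxVisible S (x, y) (x, y') ∧ lev (x, y') ≤ 2 * j + 1
  zero_ex : ∀ x y, (x, y) ∈ S → lev (x, y) = 0 →
    ∃ y' x', BoxVisible S (x, y) (x, y') ∧ BoxVisible S (x, y') (x', y') ∧ r (x, y) = (x', y') ∧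
      ∀ i, min x x' ≤ i → i ≤ max x x' → lev (i, y') = 0

section Levels

variable {S : Set (ℤ × ℤ)} {r : ℤ × ℤ → ℤ × ℤ} {lev : ℤ × ℤ → ℕ}

/-- A potential whose jumps avoid the cells of level at most `2 * j` is constant on those of one
component. -/
theorem LevelFunction.potential_eq_root (hL : LevelFunction S r lev) {F J : ℤ → ℤ → ℤ}
    (hv : ∀ x y, (x, y) ∈ S → (x, y + 1) ∈ S → F x (y + 1) = F x y)
    (hh : ∀ x y, (x, y) ∈ S → (x + 1, y) ∈ S → F (x + 1) y = F x y + J x y) {j : ℕ}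
    (hJ : ∀ x y, (x, y) ∈ S → (x + 1, y) ∈ S → lev (x, y) ≤ 2 * j → lev (x + 1, y) ≤ 2 * j →
      J x y = 0) {x y : ℤ} (hS : (x, y) ∈ S) (hxy : lev (x, y) ≤ 2 * j) :
    F x y = F (r (x, y)).1 (r (x, y)).2 := by
  have hrow : ∀ x x' y, BoxVisible S (x, y) (x', y) →
      (∀ i, min x x' ≤ i → i ≤ max x x' → lev (i, y) ≤ 2 * j) → F x y = F x' y := by
    intro x x' y hb hl
    refine potential_eq_horizontal hh hb fun i h1 h2 => hJ i y ?_ ?_ (hl i h1 (by omega))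
      (hl _ (by omega) (by omega))
    · exact hb _ _ (by simp only; omega) (by simp only; omega) (by simp) (by simp)
    · exact hb _ _ (by simp only; omega) (by simp only; omega) (by simp) (by simp)
  obtain ⟨n, hn⟩ : ∃ n, lev (x, y) = n := ⟨_, rfl⟩
  induction n using Nat.strong_induction_on generalizing x y with
  | _ n ih =>
    rcases Nat.eq_zero_or_pos n with h0 | hpos
    · obtain ⟨y', x', h1, h2, h3, h4⟩ := hL.zero_ex x y hS (by omega)
      rw [h3, potential_eq_vertical hv h1]
      exact hrow _ _ _ h2 fun i hi hi' => by rw [h4 i hi hi']; omega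
    rcases Nat.even_or_odd' n with ⟨k, hk | hk⟩
    · obtain ⟨y', h1, h2⟩ := hL.even_ex (k - 1) x y hS (by omega)
      have h3 : (x, y') ∈ S := h1 _ _ (by simp) (by simp) (by simp) (by simp)
      rw [potential_eq_vertical hv h1, hL.root_v _ _ _ h1]
      exact ih _ (by omega) h3 (by omega) rfl
    · obtain ⟨x', h1, h2⟩ := hL.odd_ex k x y hS (by omega)
      have h3 : (x', y) ∈ S := h1 _ _ (by simp) (by simp) (by simp) (by simp)
      rw [hrow _ _ _ h1, hL.root_h _ _ _ h1]
      · exact ih _ (by omega) h3 (by omega) rfl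
      · intro i hi hi'
        have : BoxVisible S (x, y) (i, y) := h1.mono (by simp only; omega) (by simp only; omega)
          (by simp) (by simp)
        have := hL.odd_h k _ _ _ this (by omega)
        omega

/-- The row of `(x, y)` leads to the right to the cell `(a, y)`, its first cell of level at most
`2 * j`. -/
def GateRight (S : Set (ℤ × ℤ)) (lev : ℤ × ℤ → ℕ) (j : ℕ) (x y a : ℤ) : Prop :=
  x < a ∧ BoxVisible S (x, y) (a, y) ∧ lev (a, y) ≤ 2 * j ∧ ∀ i, x ≤ i → i < a → 2 * j < lev (i, y)

/-- The row of `(x, y)` leads to the left to the cell `(a, y)`, its first cell of level at most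
`2 * j`. -/
def GateLeft (S : Set (ℤ × ℤ)) (lev : ℤ × ℤ → ℕ) (j : ℕ) (x y a : ℤ) : Prop :=
  a < x ∧ BoxVisible S (x, y) (a, y) ∧ lev (a, y) ≤ 2 * j ∧ ∀ i, a < i → i ≤ x → 2 * j < lev (i, y)

/-- If one cell of a vertical run reaches level at most `2 * j` by going to the right, then every
other cell of the run that reaches such a level along its row uses the same contacts between
vertical runs: otherwise cutting such a contact would not separate its two sides. -/
theorem GateRight.crosses (hS : CoConnected S) (hL : LevelFunction S r lev) {j : ℕ}
    {x y a y' a' i : ℤ} (h : GateRight S lev j x y a) (hv : BoxVisible S (x, y) (x, y'))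
    (hr : BoxVisible S (x, y') (a', y')) (ha' : lev (a', y') ≤ 2 * j) (hi : x ≤ i) (hia : i < a) :
    i < a' ∧ BoxVisible S (i, y) (i + 1, y') := by
  classical
  obtain ⟨hxa, hrow, hla, hlow⟩ := h
  have m : ∀ k, x ≤ k → k ≤ a → (k, y) ∈ S := fun k h1 h2 =>
    hrow _ _ (by simp only; omega) (by simp only; omega) (by simp) (by simp)
  obtain ⟨F, hFv, hFh⟩ := hS.hasPotential_contact (m i hi hia.le) (m (i + 1) (by omega) (by omega))
  have hroot : ∀ x y, (x, y) ∈ S → lev (x, y) ≤ 2 * j → F x y = F (r (x, y)).1 (r (x, y)).2 := by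
    intro x1 y1 h1 h2
    refine hL.potential_eq_root hFv hFh (fun x2 y2 _ _ h5 _ => if_neg ?_) h1 h2
    rintro ⟨rfl, hb⟩
    have h6 : BoxVisible S (x2, y2) (x2, y) :=
      (hb.mono (by simp) (by simp) le_rfl le_rfl : BoxVisible S (x2, y) (x2, y2)).symm
    have := hL.even_v j _ _ _ h6 h5
    have := hlow x2 hi hia
    omega
  have e1 : F x y = F i y := by
    refine potential_eq_horizontal hFh (hrow.mono (by simp only; omega) (by simp only; omega)
      (by simp) (by simp)) fun k h1 h2 => if_neg ?_
    rintro ⟨rfl, -⟩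
    omega
  have e2 : F (i + 1) y = F i y + 1 := by
    rw [hFh i y (m i hi hia.le) (m (i + 1) (by omega) (by omega))]
    beta_reduce
    rw [if_pos]
    refine ⟨rfl, hrow.mono (by simp only; omega) (by simp only; omega) (by simp) (by simp)⟩
  have e3 : F (i + 1) y = F a y := by
    refine potential_eq_horizontal hFh (hrow.mono (by simp only; omega) (by simp only; omega)
      (by simp) (by simp)) fun k h1 h2 => if_neg ?_
    rintro ⟨rfl, -⟩
    omega
  have e4 : F x y = F x y' := potential_eq_vertical hFv hv
  have e5 : F a y = F a' y' := by
    rw [hroot a y (m a (by omega) le_rfl) hla, hroot a' y'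
      (hr _ _ (by simp) (by simp) (by simp) (by simp)) ha', ← hL.root_h _ _ _ hrow,
      ← hL.root_h _ _ _ hr, hL.root_v _ _ _ hv]
  by_contra hcon
  have : F x y' = F a' y' := by
    refine potential_eq_horizontal hFh hr fun k h1 h2 => if_neg ?_
    rintro ⟨rfl, hb⟩
    exact hcon ⟨by omega, hb⟩
  omega

theorem GateRight.not_gateLeft (hS : CoConnected S) (hL : LevelFunction S r lev) {j : ℕ}
    {x y a y' a' : ℤ} (h : GateRight S lev j x y a) (hv : BoxVisible S (x, y) (x, y')) :
    ¬ GateLeft S lev j x y' a' := by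
  intro h'
  have := (h.crosses hS hL hv h'.2.1 h'.2.2.1 le_rfl h.1).1
  have := h'.1
  omega

theorem GateRight.eq (hS : CoConnected S) (hL : LevelFunction S r lev) {j : ℕ}
    {x y a y' a' : ℤ} (h : GateRight S lev j x y a) (hv : BoxVisible S (x, y) (x, y'))
    (h' : GateRight S lev j x y' a') : a = a' := by
  have h1 := h.1
  have h2 := h'.1
  have := (h.crosses hS hL hv h'.2.1 h'.2.2.1 (show x ≤ a - 1 by omega) (by omega)).1
  have := (h'.crosses hS hL hv.symm h.2.1 h.2.2.1 (show x ≤ a' - 1 by omega) (by omega)).1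
  omega

/-- The whole box between two rows that leave a vertical run towards the same gate is in `S`. -/
theorem GateRight.boxVisible (hS : CoConnected S) (hL : LevelFunction S r lev) {j : ℕ}
    {x y a y' a' : ℤ} (h : GateRight S lev j x y a) (hv : BoxVisible S (x, y) (x, y'))
    (h' : GateRight S lev j x y' a') : BoxVisible S (x, y) (a, y') := by
  intro k l h1 h2 h3 h4
  have h0 := h.1
  simp only at h1 h2 h3 h4
  by_cases hk : k < a
  · exact (h.crosses hS hL hv h'.2.1 h'.2.2.1 (show x ≤ k by omega) hk).2 _ _ (by simp) (by simp)
      h3 h4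
  · exact (h.crosses hS hL hv h'.2.1 h'.2.2.1 (show x ≤ a - 1 by omega) (by omega)).2 _ _
      (by simp only; omega) (by simp only; omega) h3 h4

theorem exists_gateLeft {j : ℕ} {x y b : ℤ} (hb : b < x) (hv : BoxVisible S (x, y) (b, y))
    (hlb : lev (b, y) ≤ 2 * j) (hx : 2 * j < lev (x, y)) : ∃ a, b ≤ a ∧ GateLeft S lev j x y a := by
  obtain ⟨a, ⟨h1, h2, h3⟩, hmax⟩ := Int.exists_greatest_of_bdd
    (P := fun i => b ≤ i ∧ i ≤ x ∧ lev (i, y) ≤ 2 * j) ⟨x, fun z hz => hz.2.1⟩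
    ⟨b, le_rfl, hb.le, hlb⟩
  have hne : a ≠ x := by rintro rfl; omega
  refine ⟨a, h1, by omega, hv.mono (by simp only; omega) (by simp only; omega) (by simp) (by simp),
    h3, fun i hi hi' => ?_⟩
  by_contra hcon
  have := hmax i ⟨by omega, hi', by omega⟩
  omega

theorem exists_gateRight {j : ℕ} {x y b : ℤ} (hb : x < b) (hv : BoxVisible S (x, y) (b, y))
    (hlb : lev (b, y) ≤ 2 * j) (hx : 2 * j < lev (x, y)) :
    ∃ a, a ≤ b ∧ GateRight S lev j x y a := by
  obtain ⟨a, ⟨h1, h2, h3⟩, hmin⟩ := Int.exists_least_of_bdd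
    (P := fun i => i ≤ b ∧ x ≤ i ∧ lev (i, y) ≤ 2 * j) ⟨x, fun z hz => hz.2.1⟩
    ⟨b, le_rfl, hb.le, hlb⟩
  have hne : a ≠ x := by rintro rfl; omega
  refine ⟨a, h1, by omega, hv.mono (by simp only; omega) (by simp only; omega) (by simp) (by simp),
    h3, fun i hi hi' => ?_⟩
  by_contra hcon
  have := hmin i ⟨by omega, hi, by omega⟩
  omega

theorem LevelFunction.gate_or_gate (hL : LevelFunction S r lev) {j : ℕ} {x y : ℤ}
    (hS : (x, y) ∈ S) (h : lev (x, y) = 2 * j + 1) :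
    (∃ a, GateLeft S lev j x y a) ∨ ∃ a, GateRight S lev j x y a := by
  obtain ⟨b, h1, h2⟩ := hL.odd_ex j x y hS h
  rcases lt_trichotomy b x with hlt | rfl | hlt
  · obtain ⟨a, -, ha⟩ := exists_gateLeft hlt h1 h2 (by omega)
    exact Or.inl ⟨a, ha⟩
  · omega
  · obtain ⟨a, -, ha⟩ := exists_gateRight hlt h1 h2 (by omega)
    exact Or.inr ⟨a, ha⟩

/-- The cells of odd level whose row leads to a lower level on the right. -/
def RightCell (S : Set (ℤ × ℤ)) (lev : ℤ × ℤ → ℕ) (x y : ℤ) : Prop :=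
  ∃ j a, lev (x, y) = 2 * j + 1 ∧ GateRight S lev j x y a

theorem RightCell.mem {x y : ℤ} (h : RightCell S lev x y) : (x, y) ∈ S := by
  obtain ⟨j, a, -, -, h, -⟩ := h
  exact h _ _ (by simp) (by simp) (by simp) (by simp)

theorem GateRight.of_le {j : ℕ} {x y a i : ℤ} (h : GateRight S lev j x y a) (hi : x ≤ i)
    (hia : i < a) : GateRight S lev j i y a :=
  ⟨hia, h.2.1.mono (by simp only; omega) (by simp only; omega) (by simp) (by simp), h.2.2.1,
    fun k h1 h2 => h.2.2.2 k (by omega) h2⟩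

theorem GateRight.lev_eq (hL : LevelFunction S r lev) {j : ℕ} {x y a i : ℤ}
    (hx : lev (x, y) = 2 * j + 1) (h : GateRight S lev j x y a) (hi : x ≤ i) (hia : i < a) :
    lev (i, y) = 2 * j + 1 := by
  have := hL.odd_h j x i y (h.2.1.mono (by simp only; omega) (by simp only; omega) (by simp)
    (by simp)) hx.le
  have := h.2.2.2 i hi hia
  omega

theorem GateRight.rightCell (hL : LevelFunction S r lev) {j : ℕ} {x y a i : ℤ}
    (hx : lev (x, y) = 2 * j + 1) (h : GateRight S lev j x y a) (hi : x ≤ i) (hia : i < a) :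
    RightCell S lev i y :=
  ⟨j, a, h.lev_eq hL hx hi hia, h.of_le hi hia⟩

/-- Two cells of odd level in one vertical run have the same level. -/
theorem LevelFunction.lev_eq_of_odd (hL : LevelFunction S r lev) {j j' : ℕ} {x y y' : ℤ}
    (hv : BoxVisible S (x, y) (x, y')) (h : lev (x, y) = 2 * j + 1)
    (h' : lev (x, y') = 2 * j' + 1) : j = j' := by
  have := hL.even_v (j + 1) _ _ _ hv (by omega)
  have := hL.even_v (j' + 1) _ _ _ hv.symm (by omega)
  omega

/-- Two visible cells of odd level have the same level. -/
theorem LevelFunction.lev_eq_of_boxVisible (hL : LevelFunction S r lev) {j j' : ℕ}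
    {x y x' y' : ℤ} (hv : BoxVisible S (x, y) (x', y')) (h : lev (x, y) = 2 * j + 1)
    (h' : lev (x', y') = 2 * j' + 1) : j = j' := by
  have h1 : BoxVisible S (x, y) (x', y) := hv.mono le_rfl le_rfl (by simp) (by simp)
  have h2 : BoxVisible S (x', y) (x', y') := hv.mono (by simp) (by simp) le_rfl le_rfl
  have h3 : BoxVisible S (x, y) (x, y') := hv.mono (by simp) (by simp) le_rfl le_rfl
  have h4 : BoxVisible S (x, y') (x', y') := hv.mono le_rfl le_rfl (by simp) (by simp)
  have := hL.odd_h j _ _ _ h1 (by omega)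
  have := hL.even_v (j + 1) _ _ _ h2 (by omega)
  have := hL.odd_h j' _ _ _ h4.symm (by omega)
  have := hL.even_v (j' + 1) _ _ _ h3.symm (by omega)
  omega

end Levels

/-! ### Guarding the right cells -/

/-- Two right cells are identified when they lie in a common vertical run. -/
def rightSetoid (S : Set (ℤ × ℤ)) (lev : ℤ × ℤ → ℕ) :
    Setoid {p : ℤ × ℤ // RightCell S lev p.1 p.2} where
  r p q := p.1.1 = q.1.1 ∧ BoxVisible S p.1 q.1
  iseqv := by
    refine ⟨fun p => ⟨rfl, fun x y h1 h2 h3 h4 => ?_⟩, fun h => ⟨h.1.symm, h.2.symm⟩,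
      fun {p q s} h h' => ⟨h.1.trans h'.1, fun x y h1 h2 h3 h4 => ?_⟩⟩
    · rw [min_self] at h1 h3
      rw [max_self] at h2 h4
      obtain rfl := le_antisymm h1 h2
      obtain rfl := le_antisymm h3 h4
      exact p.2.mem
    · have e1 := h.1
      have e2 := h'.1
      by_cases hy : min p.1.2 q.1.2 ≤ y ∧ y ≤ max p.1.2 q.1.2
      · exact h.2 x y (by omega) (by omega) hy.1 hy.2
      · exact h'.2 x y (by omega) (by omega) (by omega) (by omega)

/-- The nodes of the forest of right cells: the vertical runs, restricted to the right cells. -/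
abbrev RightNode (S : Set (ℤ × ℤ)) (lev : ℤ × ℤ → ℕ) := Quotient (rightSetoid S lev)

section Nodes

variable {S : Set (ℤ × ℤ)} {r : ℤ × ℤ → ℤ × ℤ} {lev : ℤ × ℤ → ℕ}

/-- The node of a right cell. -/
def rightNode {x y : ℤ} (h : RightCell S lev x y) : RightNode S lev :=
  Quotient.mk (rightSetoid S lev) ⟨(x, y), h⟩

theorem rightNode_eq_iff {x y x' y' : ℤ} (h : RightCell S lev x y) (h' : RightCell S lev x' y') :
    rightNode h = rightNode h' ↔ x = x' ∧ BoxVisible S (x, y) (x', y') :=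
  Quotient.eq (r := rightSetoid S lev)

theorem exists_rightNode (u : RightNode S lev) :
    ∃ x y, ∃ h : RightCell S lev x y, rightNode h = u := by
  obtain ⟨⟨⟨x, y⟩, h⟩, rfl⟩ := Quotient.exists_rep u
  exact ⟨x, y, h, rfl⟩

/-- The column of a node. -/
def nodeColumn (u : RightNode S lev) : ℤ :=
  Quotient.lift (s := rightSetoid S lev) (fun p => p.1.1) (fun _ _ h => h.1) u

/-- The parent of a node is the next one to the right along any of its rows. -/
def NodeStep (c u : RightNode S lev) : Prop :=
  ∃ x y, ∃ (h : RightCell S lev x y) (h' : RightCell S lev (x + 1) y),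
    c = rightNode h ∧ u = rightNode h'

theorem NodeStep.column {c u : RightNode S lev} (h : NodeStep c u) :
    nodeColumn u = nodeColumn c + 1 := by
  obtain ⟨x, y, h, h', rfl, rfl⟩ := h
  rfl

/-- Cells of one node share their gate, and the rows from them to the gate span a box in `S`. -/
theorem RightCell.common_gate (hS : CoConnected S) (hL : LevelFunction S r lev) {x y y' : ℤ}
    (h : RightCell S lev x y) (h' : RightCell S lev x y') (hv : BoxVisible S (x, y) (x, y')) :
    ∃ j a, lev (x, y) = 2 * j + 1 ∧ lev (x, y') = 2 * j + 1 ∧ GateRight S lev j x y a ∧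
      GateRight S lev j x y' a ∧ BoxVisible S (x, y) (a, y') := by
  obtain ⟨j, a, h1, h2⟩ := h
  obtain ⟨j', a', h1', h2'⟩ := h'
  obtain rfl := hL.lev_eq_of_odd hv h1 h1'
  obtain rfl := h2.eq hS hL hv h2'
  exact ⟨j, a, h1, h1', h2, h2', h2.boxVisible hS hL hv h2'⟩

/-- If two cells of a node are given, then each right cell further along the row of the one faces
a right cell of the same node on the row of the other. -/
theorem RightCell.transfer (hS : CoConnected S) (hL : LevelFunction S r lev) {x y y' x' : ℤ}
    (h : RightCell S lev x y) (h' : RightCell S lev x y') (hv : BoxVisible S (x, y) (x, y'))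
    (hx : x ≤ x') (hrow : ∀ i, x ≤ i → i ≤ x' → RightCell S lev i y) :
    (∀ i, x ≤ i → i ≤ x' → RightCell S lev i y') ∧ BoxVisible S (x, y) (x', y') := by
  obtain ⟨j, a, h1, h2, h3, h4, h5⟩ := h.common_gate hS hL h' hv
  have hlt : x' < a := by
    by_contra hcon
    obtain ⟨j', a', h6, h7⟩ := hrow a h3.1.le (by omega)
    have := h3.2.2.1
    have e1 : BoxVisible S (x, y) (a, y) := h3.2.1
    have := hL.odd_h j' _ _ _ e1.symm (by omega)
    have hj : j' < j := by omega
    omega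
  refine ⟨fun i hi hi' => h4.rightCell hL h2 hi (by omega), ?_⟩
  exact h5.mono (by simp only; omega) (by simp only; omega) le_rfl le_rfl

theorem NodeStep.unique (hS : CoConnected S) (hL : LevelFunction S r lev)
    (c u u' : RightNode S lev) (h : NodeStep c u) (h' : NodeStep c u') : u = u' := by
  obtain ⟨x, y, h1, h2, rfl, rfl⟩ := h
  obtain ⟨x', y', h3, h4, h5, rfl⟩ := h'
  obtain ⟨rfl, hv⟩ := (rightNode_eq_iff _ _).1 h5
  rw [rightNode_eq_iff]
  have := (h1.transfer hS hL h3 hv (x' := x + 1) (by omega) fun i hi hi' => by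
    rcases (show i = x ∨ i = x + 1 by omega) with rfl | rfl
    · exact h1
    · exact h2).2
  exact ⟨rfl, this.mono (by simp) (by simp) le_rfl le_rfl⟩

theorem reflTransGen_of_row {x y x' : ℤ} (hx : x ≤ x')
    (hrow : ∀ i, x ≤ i → i ≤ x' → RightCell S lev i y) :
    ReflTransGen NodeStep (rightNode (hrow x le_rfl hx)) (rightNode (hrow x' hx le_rfl)) := by
  induction x', hx using Int.leInduction with
  | base => exact .refl
  | succ b hb ih =>
    refine (ih fun i h1 h2 => hrow i h1 (by omega)).tail ?_
    exact ⟨b, y, hrow b hb (by omega), hrow (b + 1) (by omega) le_rfl, rfl, rfl⟩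

theorem exists_row_of_reflTransGen (hS : CoConnected S) (hL : LevelFunction S r lev) {x y : ℤ}
    (h : RightCell S lev x y) {u : RightNode S lev} (hu : ReflTransGen NodeStep (rightNode h) u) :
    ∃ x', ∃ hx : x ≤ x', ∃ hrow : ∀ i, x ≤ i → i ≤ x' → RightCell S lev i y,
      u = rightNode (hrow x' hx le_rfl) := by
  induction hu with
  | refl =>
    refine ⟨x, le_rfl, fun i h1 h2 => ?_, rfl⟩
    obtain rfl : i = x := by omega
    exact h
  | tail _ hbc ih =>
    obtain ⟨x', hx, hrow, rfl⟩ := ih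
    obtain ⟨x1, y1, h1, h2, h3, rfl⟩ := hbc
    obtain ⟨rfl, hv⟩ := (rightNode_eq_iff _ _).1 h3
    have ht := h1.transfer hS hL (hrow x' hx le_rfl) hv.symm (x' := x' + 1) (by omega)
      fun i hi hi' => by
        rcases (show i = x' ∨ i = x' + 1 by omega) with rfl | rfl
        · exact h1
        · exact h2
    refine ⟨x' + 1, by omega, fun i hi hi' => ?_, ?_⟩
    · by_cases hle : i ≤ x'
      · exact hrow i hi hle
      · exact ht.1 i (by omega) hi'
    · rw [rightNode_eq_iff]
      exact ⟨rfl, ht.2.mono (by simp) (by simp) le_rfl le_rfl⟩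

/-- A right cell `p` that sees a right cell `g` not to its left lies below the node of `g` in the
forest, and the row of `g` consists of right cells from the column of `p` on. -/
theorem RightCell.visible_right (hS : CoConnected S) (hL : LevelFunction S r lev) {x y x' y' : ℤ}
    (hp : RightCell S lev x y) (hg : RightCell S lev x' y')
    (hv : BoxVisible S (x, y) (x', y')) (hx : x ≤ x') :
    ∃ (h1 : ∀ i, x ≤ i → i ≤ x' → RightCell S lev i y)
      (h2 : ∀ i, x ≤ i → i ≤ x' → RightCell S lev i y'),
      rightNode (h1 x' hx le_rfl) = rightNode hg ∧ rightNode hp = rightNode (h2 x le_rfl hx) := by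
  obtain ⟨j, a, hp1, hp2⟩ := id hp
  obtain ⟨j', b, hg1, hg2⟩ := id hg
  obtain rfl := hL.lev_eq_of_boxVisible hv hp1 hg1
  have hcol : ∀ i, x ≤ i → i ≤ x' → BoxVisible S (i, y) (i, y') := fun i h1 h2 =>
    hv.mono (by simp only; omega) (by simp only; omega) le_rfl le_rfl
  have hlt : x' < a := by
    -- Otherwise the corner cell `(x', y)` would have its gate on the left, and `g` on the right.
    by_contra hcon
    have hxa := hp2.1
    have hne : a ≠ x' := by
      rintro rfl
      have := hL.even_v j _ _ _ (hcol a hx le_rfl) hp2.2.2.1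
      omega
    have hlev : 2 * j < lev (x', y) := by
      by_contra hle
      have := hL.even_v j _ _ _ (hcol x' hx le_rfl) (by omega)
      omega
    obtain ⟨c, -, hc⟩ := exists_gateLeft (S := S) (j := j) (y := y) (show a < x' by omega)
      (hv.mono (by simp only; omega) (by simp only; omega) (by simp) (by simp)) hp2.2.2.1 hlev
    exact hg2.not_gateLeft hS hL (hcol x' hx le_rfl).symm hc
  have h1 : ∀ i, x ≤ i → i ≤ x' → RightCell S lev i y := fun i h h' =>
    hp2.rightCell hL hp1 h (by omega)
  have hlow : ∀ i, x ≤ i → i < b → 2 * j < lev (i, y') := by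
    intro i hi hib
    by_cases hle : x' ≤ i
    · exact hg2.2.2.2 i hle hib
    · by_contra hcon
      have := hL.even_v j _ _ _ (hcol i hi (by omega)).symm (by omega)
      have := hp2.2.2.2 i hi (by omega)
      omega
  have hgate : GateRight S lev j x y' b := by
    have := hg2.1
    refine ⟨by omega, fun k l h1 h2 h3 h4 => ?_, hg2.2.2.1, hlow⟩
    simp only at h1 h2 h3 h4
    by_cases hk : k ≤ x'
    · exact hv _ _ (by simp only; omega) (by simp only; omega) (by simp only; omega)
        (by simp only; omega)
    · exact hg2.2.1 _ _ (by simp only; omega) (by simp only; omega) (by simp only; omega)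
        (by simp only; omega)
  have hl : lev (x, y') = 2 * j + 1 := by
    have := hL.odd_h j x' x y' (hv.mono (by simp only; omega) (by simp only; omega)
      (by simp) (by simp)) (by omega)
    have := hlow x le_rfl hgate.1
    omega
  have h2 : ∀ i, x ≤ i → i ≤ x' → RightCell S lev i y' := fun i h h' =>
    hgate.rightCell hL hl h (by have := hg2.1; omega)
  exact ⟨h1, h2, (rightNode_eq_iff _ _).2 ⟨rfl, hcol x' hx le_rfl⟩,
    (rightNode_eq_iff _ _).2 ⟨rfl, hcol x le_rfl hx⟩⟩

/-- The core of the argument: conflict-free guards for the right cells, one for each heavy path.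
The guard of a heavy path stands in the column of its head, on a row that runs through all of its
nodes. A right cell sees the guard of the heavy path of its own node and those of the heavy paths
whose heads lie on its row further left, and these have consecutive light depths. -/
theorem exists_conflictFree_rightCells (hS : CoConnected S) (hL : LevelFunction S r lev)
    (hfin : S.Finite) :
    ∃ (G : Finset (ℤ × ℤ)) (γ : ℤ × ℤ → ℕ), (∀ g ∈ G, RightCell S lev g.1 g.2) ∧
      (∀ g ∈ G, γ g ≤ Nat.log 2 (Nat.log 2 S.ncard + 1)) ∧
      ∀ x y, RightCell S lev x y → ∃ g ∈ G, BoxVisible S (x, y) g ∧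
        ∀ g' ∈ G, BoxVisible S (x, y) g' → γ g' = γ g → g' = g := by
  classical
  have hfinX : Finite {p : ℤ × ℤ // RightCell S lev p.1 p.2} :=
    (hfin.subset (t := {p : ℤ × ℤ | RightCell S lev p.1 p.2})
      fun p hp => RightCell.mem hp).to_subtype
  have hcard : Nat.card (RightNode S lev) ≤ S.ncard := by
    refine (Nat.card_le_card_of_surjective _ Quotient.mk_surjective).trans ?_
    exact Set.ncard_le_ncard (s := {p : ℤ × ℤ | RightCell S lev p.1 p.2})
      (fun p hp => RightCell.mem hp) hfin
  have hR := NodeStep.unique hS hL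
  have hrk : ∀ c u : RightNode S lev, NodeStep c u → nodeColumn u = nodeColumn c + 1 :=
    fun c u h => h.column
  obtain ⟨H, l, hHR, hH1, hH2, hl, hl', hbound⟩ :=
    exists_heavy_path_decomposition (NodeStep (S := S) (lev := lev)) hR nodeColumn hrk
  have hHrk : ∀ c u, H c u → nodeColumn c < nodeColumn u := fun c u h => by
    have := hrk _ _ (hHR _ _ h)
    omega
  have hHR' : ∀ {w u}, ReflTransGen H w u → ReflTransGen NodeStep w u := fun h =>
    ReflTransGen.mono (fun _ _ h => hHR _ _ h) _ _ h
  have htail : ∀ u : RightNode S lev, ∃ y, ∃ x, ∃ hx : x ≤ nodeColumn u,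
      ∃ hrow : ∀ i, x ≤ i → i ≤ nodeColumn u → RightCell S lev i y,
      u = rightNode (hrow _ hx le_rfl) ∧ ReflTransGen H (rightNode (hrow x le_rfl hx)) u ∧
      (∀ c, ¬ H c (rightNode (hrow x le_rfl hx))) ∧ ¬ RightCell S lev (x - 1) y := by
    intro u
    obtain ⟨w, hw, hw'⟩ := exists_leaf hHrk u
    obtain ⟨x, y, h, rfl⟩ := exists_rightNode w
    obtain ⟨x', hx, hrow, hu⟩ := exists_row_of_reflTransGen hS hL h (hHR' hw)
    obtain rfl : nodeColumn u = x' := by rw [hu]; rfl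
    refine ⟨y, x, hx, hrow, hu, hw, hw', fun hcon => ?_⟩
    obtain ⟨c, hc⟩ := hH2 (rightNode h) ⟨rightNode hcon, x - 1, y, hcon, by simpa using h, rfl, by
      simp⟩
    exact hw' c hc
  choose Y X hX hrowY hnodeY hheavyY hleafH hleafY using htail
  let guard : RightNode S lev → ℤ × ℤ := fun u => (nodeColumn u, Y u)
  let head : RightNode S lev → Prop := fun u => ∀ w, ¬ H u w
  have hguard : ∀ u, RightCell S lev (nodeColumn u) (Y u) := fun u => hrowY u _ (hX u) le_rfl
  let γ : ℤ × ℤ → ℕ := fun p =>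
    if h : RightCell S lev p.1 p.2 then rulerColor (l (rightNode h)) else 0
  have hγ : ∀ u, γ (guard u) = rulerColor (l u) := by
    intro u
    simp only [γ, guard, dif_pos (hguard u), ← hnodeY u]
  have := Fintype.ofFinite (RightNode S lev)
  refine ⟨(Finset.univ.filter head).image guard, γ, ?_, ?_, ?_⟩
  · intro g hg
    obtain ⟨u, -, rfl⟩ := Finset.mem_image.1 hg
    exact hguard u
  · intro g hg
    obtain ⟨u, -, rfl⟩ := Finset.mem_image.1 hg
    rw [hγ]
    apply rulerColor_le_log
    apply Nat.le_log_of_pow_le (by norm_num)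
    exact (hbound u).trans hcard
  intro x y hp
  -- the leftmost right cell on the row of the given cell
  obtain ⟨z, ⟨hzx, hz⟩, hzmin⟩ : ∃ z, (z ≤ x ∧ ∀ i, z ≤ i → i ≤ x → RightCell S lev i y) ∧
      ∀ z', (z' ≤ x ∧ ∀ i, z' ≤ i → i ≤ x → RightCell S lev i y) → z ≤ z' := by
    obtain ⟨b, hb⟩ := (hfin.image Prod.fst).bddBelow
    refine Int.exists_least_of_bdd ⟨b, fun z hz => ?_⟩ ⟨x, le_rfl, fun i h1 h2 => ?_⟩
    · exact hb ⟨_, (hz.2 z le_rfl hz.1).mem, rfl⟩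
    · obtain rfl : i = x := by omega
      exact hp
  have hzv : ReflTransGen NodeStep (rightNode (hz z le_rfl hzx)) (rightNode hp) :=
    reflTransGen_of_row hzx hz
  -- a visible guard belongs to the heavy path of the node or to a head further left on the row
  have hvis : ∀ u, head u → BoxVisible S (x, y) (guard u) → ReflTransGen H (rightNode hp) u ∨
      ReflTransGen NodeStep (rightNode (hz z le_rfl hzx)) u ∧
        ReflTransGen NodeStep u (rightNode hp) ∧ u ≠ rightNode hp := by
    intro u hu hv
    rcases le_or_gt x (nodeColumn u) with hle | hlt
    · obtain ⟨h1, h2, h3, h4⟩ := hp.visible_right hS hL (hguard u) hv hle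
      left
      have hXx : X u ≤ x := by
        by_contra hcon
        exact hleafY u (h2 _ (by omega) (by have := hX u; omega))
      refine (ReflTransGen.split_sub hR hrk hHR (hheavyY u) ?_ ?_).2
      · rw [h4]
        exact reflTransGen_of_row hXx fun i h1 h2 => hrowY u i h1 (h2.trans hle)
      · have := reflTransGen_of_row hle h1
        rwa [h3, ← hnodeY u] at this
    · obtain ⟨h1, h2, h3, h4⟩ := (hguard u).visible_right hS hL hp hv.symm hlt.le
      right
      have hzu : z ≤ nodeColumn u := by
        exact hzmin _ ⟨hlt.le, h2⟩
      have hu' : u = rightNode (hz _ hzu hlt.le) := by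
        exact (hnodeY u).trans h4
      refine ⟨?_, ?_, ?_⟩
      · rw [hu']
        exact reflTransGen_of_row hzu fun i h1 h2 => hz i h1 (h2.trans hlt.le)
      · rw [hu']
        exact reflTransGen_of_row hlt.le h2
      · rintro rfl
        exact lt_irrefl _ hlt
  have hlabel : ∀ u, head u → BoxVisible S (x, y) (guard u) →
      l (rightNode hp) ≤ l u ∧ l u ≤ l (rightNode (hz z le_rfl hzx)) := by
    intro u hu hv
    rcases hvis u hu hv with h | ⟨h1, h2, -⟩
    · rw [← lightDepth_eq hl h]
      exact ⟨le_rfl, lightDepth_le hl hl' hzv⟩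
    · exact ⟨lightDepth_le hl hl' h2, lightDepth_le hl hl' h1⟩
  obtain ⟨m, hm1, hm2, hm3⟩ := exists_unique_rulerColor (lightDepth_le hl hl' hzv)
  -- there is a visible guard of light depth `m`
  obtain ⟨u, hu, hum, hucase, huv⟩ : ∃ u, head u ∧ l u = m ∧
      ((ReflTransGen H (rightNode hp) u ∧ m = l (rightNode hp)) ∨
        ReflTransGen NodeStep (rightNode (hz z le_rfl hzx)) u ∧
        ReflTransGen NodeStep u (rightNode hp) ∧ u ≠ rightNode hp) ∧
      BoxVisible S (x, y) (guard u) := by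
    rcases hm1.eq_or_lt with heq | hlt
    · obtain ⟨u, hu, hu'⟩ := exists_head hHrk (rightNode hp)
      refine ⟨u, hu', by rw [← heq, lightDepth_eq hl hu], Or.inl ⟨hu, heq.symm⟩, ?_⟩
      obtain ⟨x', hx', hrow', hux'⟩ := exists_row_of_reflTransGen hS hL hp (hHR' hu)
      have hcx : nodeColumn u = x' := by rw [hux']; rfl
      -- the tail of the heavy path lies in the subtree of the given node
      have hXp : ReflTransGen NodeStep (rightNode (hrowY u _ le_rfl (hX u))) (rightNode hp) := by
        -- both are joined to the head by heavy edges, and the tail has no heavy child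
        have hflip : ∀ {a b}, ReflTransGen H a b → ReflTransGen (fun a b => H b a) b a :=
          fun h => h.swap
        rcases ReflTransGen.comparable (R := fun a b => H b a)
          (fun c u u' h h' => hH1 _ _ _ h h') (hflip (hheavyY u)) (hflip hu) with h | h
        · have h' : ReflTransGen H (rightNode hp) (rightNode (hrowY u _ le_rfl (hX u))) := h.swap
          rcases ReflTransGen.cases_tail h' with h'' | ⟨c, -, hc⟩
          · rw [← h'']
          · exact (hleafH u c hc).elim
        · exact hHR' h.swap
      obtain ⟨x1, hx1, hrow1, hu1⟩ := exists_row_of_reflTransGen hS hL _ hXp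
      obtain ⟨rfl, hv1⟩ := (rightNode_eq_iff _ _).1 hu1
      have := (hp.transfer hS hL (hrow1 x hx1 le_rfl) hv1 hx' hrow').2
      rwa [← hcx] at this
    · obtain ⟨u, h1, h2, h3, h4, h5⟩ := exists_head_of_lightDepth hl hl' hR hHR hzv hlt hm2
      refine ⟨u, h1, h2, Or.inr ⟨h3, h4, h5⟩, ?_⟩
      obtain ⟨x', hx', hrow', hux'⟩ := exists_row_of_reflTransGen hS hL (hz z le_rfl hzx) h3
      have hcx : nodeColumn u = x' := by rw [hux']; rfl
      subst hcx
      have hle : nodeColumn u ≤ x := ReflTransGen.rank_le hrk h4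
      obtain ⟨-, hv1⟩ := (rightNode_eq_iff _ _).1 (hux'.symm.trans (hnodeY u))
      have := ((hrow' _ hx' le_rfl).transfer hS hL (hguard u) hv1 hle
        fun i h h' => hz i (hx'.trans h) h').2
      exact this.mono (by simp [min_comm]) (by simp [max_comm]) le_rfl le_rfl
  refine ⟨guard u, Finset.mem_image_of_mem _ (by simpa using hu), huv, fun g' hg' hv' hc => ?_⟩
  obtain ⟨u', hu', rfl⟩ := Finset.mem_image.1 hg'
  replace hu' : head u' := by simpa using hu'
  have hum' : l u' = m := by
    rw [hγ, hγ, hum] at hc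
    have := hlabel u' hu' hv'
    exact hm3 _ this.1 this.2 hc
  congr 1
  rcases hvis u' hu' hv' with h | ⟨h1, h2, h3⟩
  · rcases hucase with ⟨h', -⟩ | ⟨h1', h2', h3'⟩
    · rcases ReflTransGen.comparable (fun c u u' h h' => hR c u u' (hHR _ _ h) (hHR _ _ h')) h h'
        with h'' | h''
      · rcases ReflTransGen.cases_head h'' with h'' | ⟨d, hd, -⟩
        · exact h''
        · exact (hu' d hd).elim
      · rcases ReflTransGen.cases_head h'' with h'' | ⟨d, hd, -⟩
        · exact h''.symm
        · exact (hu d hd).elim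
    · have := lightDepth_lt_of_head hl hl' h2' h3' hu
      have := lightDepth_eq hl h
      omega
  · rcases hucase with ⟨-, h'⟩ | ⟨h1', h2', h3'⟩
    · have := lightDepth_lt_of_head hl hl' h2 h3 hu'
      omega
    · by_contra hne
      rcases ReflTransGen.comparable hR h1 h1' with h'' | h''
      · have := lightDepth_lt_of_head hl hl' h'' hne hu'
        omega
      · have := lightDepth_lt_of_head hl hl' h'' (Ne.symm hne) hu
        omega

end Nodes

/-! ### Conflict-free guardings of lattice sets -/

/-- The cells of `X` can be guarded without conflicts by finitely many guards in `X` and with `t`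
colors, for visibility in `S`. -/
def ConflictFreeGuardable (S X : Set (ℤ × ℤ)) (t : ℕ) : Prop :=
  ∃ (G : Finset (ℤ × ℤ)) (γ : ℤ × ℤ → ℕ), (∀ g ∈ G, g ∈ X) ∧ (∀ g ∈ G, γ g < t) ∧
    ∀ p ∈ X, ∃ g ∈ G, BoxVisible S p g ∧ ∀ g' ∈ G, BoxVisible S p g' → γ g' = γ g → g' = g

theorem ConflictFreeGuardable.union {S X X' : Set (ℤ × ℤ)} {t : ℕ}
    (h : ConflictFreeGuardable S X t) (h' : ConflictFreeGuardable S X' t) (hd : Disjoint X X') :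
    ConflictFreeGuardable S (X ∪ X') (2 * t) := by
  classical
  obtain ⟨G, γ, h1, h2, h3⟩ := h
  obtain ⟨G', γ', h1', h2', h3'⟩ := h'
  have hnot : ∀ g ∈ G', g ∉ X := fun g hg hgX => Set.disjoint_left.1 hd hgX (h1' g hg)
  refine ⟨G ∪ G', fun g => if g ∈ X then 2 * γ g else 2 * γ' g + 1, ?_, ?_, ?_⟩
  · intro g hg
    rcases Finset.mem_union.1 hg with hg | hg
    · exact Or.inl (h1 g hg)
    · exact Or.inr (h1' g hg)
  · intro g hg
    rcases Finset.mem_union.1 hg with hg | hg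
    · have := h2 g hg
      simp only [h1 g hg, if_true]
      omega
    · have := h2' g hg
      simp only [hnot g hg, if_false]
      omega
  · rintro p (hp | hp)
    · obtain ⟨g, hg, hv, hu⟩ := h3 p hp
      refine ⟨g, Finset.mem_union_left _ hg, hv, fun g' hg' hv' hc => ?_⟩
      rcases Finset.mem_union.1 hg' with hg' | hg'
      · simp only [h1 g hg, h1 g' hg', if_true] at hc
        exact hu g' hg' hv' (by omega)
      · simp only [h1 g hg, hnot g' hg', if_true, if_false] at hc
        omega
    · obtain ⟨g, hg, hv, hu⟩ := h3' p hp
      refine ⟨g, Finset.mem_union_right _ hg, hv, fun g' hg' hv' hc => ?_⟩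
      rcases Finset.mem_union.1 hg' with hg' | hg'
      · simp only [hnot g hg, h1 g' hg', if_true, if_false] at hc
        omega
      · simp only [hnot g hg, hnot g' hg', if_false] at hc
        exact hu g' hg' hv' (by omega)

theorem ConflictFreeGuardable.mono {S X : Set (ℤ × ℤ)} {t t' : ℕ}
    (h : ConflictFreeGuardable S X t) (ht : t ≤ t') : ConflictFreeGuardable S X t' := by
  obtain ⟨G, γ, h1, h2, h3⟩ := h
  exact ⟨G, γ, h1, fun g hg => (h2 g hg).trans_le ht, h3⟩

/-- Guardings are transported by the symmetries of the lattice. -/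
theorem ConflictFreeGuardable.transport {S S' X : Set (ℤ × ℤ)} {t : ℕ} {e : ℤ × ℤ → ℤ × ℤ}
    (he : ∀ p, e (e p) = p) (hS : ∀ p q, BoxVisible S' (e p) (e q) ↔ BoxVisible S p q)
    (h : ConflictFreeGuardable S' X t) : ConflictFreeGuardable S {p | e p ∈ X} t := by
  classical
  obtain ⟨G, γ, h1, h2, h3⟩ := h
  refine ⟨G.image e, fun p => γ (e p), ?_, ?_, ?_⟩
  · intro g hg
    obtain ⟨g', hg', rfl⟩ := Finset.mem_image.1 hg
    simpa [he] using h1 g' hg'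
  · intro g hg
    obtain ⟨g', hg', rfl⟩ := Finset.mem_image.1 hg
    simpa [he] using h2 g' hg'
  · intro p hp
    obtain ⟨g, hg, hv, hu⟩ := h3 _ hp
    refine ⟨e g, Finset.mem_image_of_mem _ hg, ?_, fun g' hg' hv' hc => ?_⟩
    · rw [← hS, he]
      exact hv
    · obtain ⟨s, hs, rfl⟩ := Finset.mem_image.1 hg'
      rw [← hS, he] at hv'
      simp only [he] at hc
      rw [hu s hs hv' hc]

theorem boxVisible_swap {S : Set (ℤ × ℤ)} {a b c d : ℤ} :
    BoxVisible {p | (p.2, p.1) ∈ S} (a, b) (c, d) ↔ BoxVisible S (b, a) (d, c) :=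
  ⟨fun h x y h1 h2 h3 h4 => h y x h3 h4 h1 h2, fun h x y h1 h2 h3 h4 => h y x h3 h4 h1 h2⟩

theorem boxVisible_neg {S : Set (ℤ × ℤ)} {a b c d : ℤ} :
    BoxVisible {p | (-p.1, p.2) ∈ S} (a, b) (c, d) ↔ BoxVisible S (-a, b) (-c, d) := by
  refine ⟨fun h x y h1 h2 h3 h4 => ?_, fun h x y h1 h2 h3 h4 => ?_⟩
  · have := h (-x) y (by simp only at h1 h2 ⊢; omega) (by simp only at h1 h2 ⊢; omega) h3 h4
    simpa using this
  · exact h (-x) y (by simp only at h1 h2 ⊢; omega) (by simp only at h1 h2 ⊢; omega) h3 h4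

/-! ### Reflections -/

section Symmetry

variable {S : Set (ℤ × ℤ)} {r : ℤ × ℤ → ℤ × ℤ} {lev : ℤ × ℤ → ℕ}

theorem LevelFunction.neg (hL : LevelFunction S r lev) :
    LevelFunction {p | (-p.1, p.2) ∈ S}
      (fun p => (-(r (-p.1, p.2)).1, (r (-p.1, p.2)).2)) fun p => lev (-p.1, p.2) where
  root_v x y y' h := by simp only [hL.root_v _ _ _ (boxVisible_neg.1 h)]
  root_h x x' y h := by simp only [hL.root_h _ _ _ (boxVisible_neg.1 h)]
  even_v j x y y' h h' := hL.even_v j _ _ _ (boxVisible_neg.1 h) h'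
  odd_h j x x' y h h' := hL.odd_h j _ _ _ (boxVisible_neg.1 h) h'
  odd_ex j x y h h' := by
    obtain ⟨x', h1, h2⟩ := hL.odd_ex j (-x) y h h'
    exact ⟨-x', boxVisible_neg.2 (by simpa using h1), by simpa using h2⟩
  even_ex j x y h h' := by
    obtain ⟨y', h1, h2⟩ := hL.even_ex j (-x) y h h'
    exact ⟨y', boxVisible_neg.2 h1, h2⟩
  zero_ex x y h h' := by
    obtain ⟨y', x', h1, h2, h3, h4⟩ := hL.zero_ex (-x) y h h'
    refine ⟨y', -x', boxVisible_neg.2 h1, boxVisible_neg.2 (by simpa using h2), by simp [h3],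
      fun i hi hi' => h4 (-i) (by omega) (by omega)⟩

/-- After swapping the coordinates, the levels zero and one together play the role of level zero. -/
theorem LevelFunction.swap (hL : LevelFunction S r lev)
    (hz : ∀ x y, (x, y) ∈ S → lev (x, y) = 0 →
      (r (x, y)).1 = x ∧ BoxVisible S (x, y) (r (x, y))) :
    LevelFunction {p | (p.2, p.1) ∈ S}
      (fun p => ((r (p.2, p.1)).2, (r (p.2, p.1)).1)) fun p => lev (p.2, p.1) - 1 where
  root_v x y y' h := by simp only [hL.root_h _ _ _ (boxVisible_swap.1 h)]
  root_h x x' y h := by simp only [hL.root_v _ _ _ (boxVisible_swap.1 h)]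
  even_v j x y y' h h' := by
    have := hL.odd_h j _ _ _ (boxVisible_swap.1 h) (by simp only at h'; omega)
    simp only
    omega
  odd_h j x x' y h h' := by
    have := hL.even_v (j + 1) _ _ _ (boxVisible_swap.1 h) (by simp only at h'; omega)
    simp only
    omega
  odd_ex j x y h h' := by
    obtain ⟨y', h1, h2⟩ := hL.even_ex j y x h (by simp only at h'; omega)
    exact ⟨y', boxVisible_swap.2 h1, by simp only; omega⟩
  even_ex j x y h h' := by
    obtain ⟨x', h1, h2⟩ := hL.odd_ex (j + 1) y x h (by simp only at h'; omega)
    exact ⟨x', boxVisible_swap.2 h1, by simp only; omega⟩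
  zero_ex x y h h' := by
    have hlev : lev (y, x) ≤ 1 := by simp only at h'; omega
    obtain ⟨x', h1, h2⟩ : ∃ x', BoxVisible S (y, x) (x', x) ∧ lev (x', x) = 0 := by
      rcases Nat.le_one_iff_eq_zero_or_eq_one.1 hlev with h0 | h0
      · exact ⟨y, boxVisible_self h, h0⟩
      · obtain ⟨x', h1, h2⟩ := hL.odd_ex 0 y x h (by omega)
        exact ⟨x', h1, by omega⟩
    obtain ⟨e1, e2⟩ := hz x' x (h1 _ _ (by simp) (by simp) (by simp) (by simp)) h2
    rw [← hL.root_h _ _ _ h1] at e1 e2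
    obtain ⟨u, v, hr⟩ : ∃ u v, r (y, x) = (u, v) := ⟨_, _, rfl⟩
    rw [hr] at e1 e2
    simp only at e1
    subst e1
    refine ⟨u, v, boxVisible_swap.2 h1, boxVisible_swap.2 e2, by simp [hr], fun i hi hi' => ?_⟩
    have := hL.even_v 0 _ _ _ (e2.mono (a := u) (c := u) (b := x) (d := i) (by simp) (by simp)
      (by simp only; omega) (by simp only; omega)) (by omega)
    simp only
    omega

/-- The cells of odd level can be guarded by the guards for the right cells and for their mirror
images. -/
theorem LevelFunction.guardable_odd (hS : CoConnected S) (hL : LevelFunction S r lev)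
    (hfin : S.Finite) :
    ConflictFreeGuardable S {p | p ∈ S ∧ lev p % 2 = 1}
      (2 * (Nat.log 2 (Nat.log 2 S.ncard + 1) + 1)) := by
  let e : ℤ × ℤ → ℤ × ℤ := fun p => (-p.1, p.2)
  have he : ∀ p, e (e p) = p := fun p => by simp [e]
  have hpre : {p : ℤ × ℤ | (-p.1, p.2) ∈ S} = e '' S := by
    ext p
    constructor
    · intro h
      exact ⟨e p, h, he p⟩
    · rintro ⟨q, hq, rfl⟩
      simpa [e] using hq
  have hfin' : {p : ℤ × ℤ | (-p.1, p.2) ∈ S}.Finite := by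
    rw [hpre]
    exact hfin.image e
  have hcard : {p : ℤ × ℤ | (-p.1, p.2) ∈ S}.ncard = S.ncard := by
    rw [hpre]
    exact Set.ncard_image_of_injective _ (Function.LeftInverse.injective he)
  have hright : ∀ {S : Set (ℤ × ℤ)} {r lev}, CoConnected S → LevelFunction S r lev → S.Finite →
      ConflictFreeGuardable S {p | RightCell S lev p.1 p.2}
        (Nat.log 2 (Nat.log 2 S.ncard + 1) + 1) := by
    intro S r lev hS hL hfin
    obtain ⟨G, γ, h1, h2, h3⟩ := exists_conflictFree_rightCells hS hL hfin
    exact ⟨G, γ, h1, fun g hg => Nat.lt_succ_of_le (h2 g hg), fun p hp => h3 p.1 p.2 hp⟩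
  have h1 := hright hS hL hfin
  have h2 := (hright hS.neg hL.neg hfin').transport (S := S) (e := e) he
    fun p q => by rw [boxVisible_neg]; simp
  rw [hcard] at h2
  have hleft : ∀ x y j a, GateRight {p | (-p.1, p.2) ∈ S} (fun p => lev (-p.1, p.2)) j (-x) y a ↔
      GateLeft S lev j x y (-a) := by
    intro x y j a
    unfold GateRight GateLeft
    rw [boxVisible_neg, neg_neg]
    refine and_congr (by omega) (and_congr Iff.rfl (and_congr Iff.rfl ⟨fun h i hi hi' => ?_,
      fun h i hi hi' => ?_⟩))
    · simpa using h (-i) (by omega) (by omega)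
    · simpa using h (-i) (by omega) (by omega)
  have h3 := h1.union h2 ?_
  · convert h3 using 1
    ext ⟨x, y⟩
    constructor
    · rintro ⟨hxy, hodd⟩
      have hj : lev (x, y) = 2 * (lev (x, y) / 2) + 1 := by omega
      rcases hL.gate_or_gate hxy hj with ⟨a, ha⟩ | ⟨a, ha⟩
      · refine Or.inr ⟨lev (x, y) / 2, -a, by simpa [e] using hj, ?_⟩
        exact (hleft _ _ _ _).2 (by simpa using ha)
      · exact Or.inl ⟨_, a, hj, ha⟩
    · rintro (⟨j, a, h4, h5⟩ | ⟨j, a, h4, h5⟩)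
      · exact ⟨h5.2.1.left_mem, by simp only at h4; omega⟩
      · have := (hleft _ _ _ _).1 h5
        simp only [e, neg_neg] at h4
        exact ⟨this.2.1.left_mem, by omega⟩
  · rw [Set.disjoint_left]
    rintro ⟨x, y⟩ ⟨j, a, h4, h5⟩ ⟨j', a', h6, h7⟩
    simp only [e, neg_neg] at h4 h5 h6
    obtain rfl : j = j' := by omega
    exact h5.not_gateLeft hS hL (boxVisible_self h5.2.1.left_mem) ((hleft _ _ _ _).1 h7)

end Symmetry

/-! ### The breadth-first search -/

section Search

variable {S : Set (ℤ × ℤ)}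

/-- Two cells in a common run. -/
def Aligned (S : Set (ℤ × ℤ)) (p q : ℤ × ℤ) : Prop := (p.1 = q.1 ∨ p.2 = q.2) ∧ BoxVisible S p q

/-- A representative of the connected component of a cell. -/
noncomputable def componentRoot (S : Set (ℤ × ℤ)) (p : ℤ × ℤ) : ℤ × ℤ := (Quot.mk (Aligned S) p).out

/-- The cells reached from `ρ` along at most `k + 1` alternately vertical and horizontal runs, the
first of them vertical. -/
def reach (S : Set (ℤ × ℤ)) (ρ : ℤ × ℤ) : ℕ → Set (ℤ × ℤ)
  | 0 => {q | ρ.1 = q.1 ∧ BoxVisible S ρ q}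
  | k + 1 => {q | ∃ p ∈ reach S ρ k, BoxVisible S p q ∧
      if Even k then p.2 = q.2 else p.1 = q.1}

theorem BoxVisible.trans_v {p q s : ℤ × ℤ} (h : BoxVisible S p q) (h' : BoxVisible S q s)
    (e : p.1 = q.1) (e' : q.1 = s.1) : BoxVisible S p s := by
  intro x y h1 h2 h3 h4
  by_cases hy : min p.2 q.2 ≤ y ∧ y ≤ max p.2 q.2
  · exact h x y (by omega) (by omega) hy.1 hy.2
  · exact h' x y (by omega) (by omega) (by omega) (by omega)

theorem BoxVisible.trans_h {p q s : ℤ × ℤ} (h : BoxVisible S p q) (h' : BoxVisible S q s)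
    (e : p.2 = q.2) (e' : q.2 = s.2) : BoxVisible S p s := by
  intro x y h1 h2 h3 h4
  by_cases hx : min p.1 q.1 ≤ x ∧ x ≤ max p.1 q.1
  · exact h x y hx.1 hx.2 (by omega) (by omega)
  · exact h' x y (by omega) (by omega) (by omega) (by omega)

theorem reach_subset (ρ : ℤ × ℤ) (k : ℕ) : reach S ρ k ⊆ S := by
  cases k with
  | zero => exact fun q hq => hq.2.right_mem
  | succ k =>
    rintro q ⟨p, -, h, -⟩
    exact h.right_mem

theorem reach_mono (ρ : ℤ × ℤ) : Monotone (reach S ρ) := by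
  refine monotone_nat_of_le_succ fun k p hp => ?_
  exact ⟨p, hp, boxVisible_self (reach_subset ρ k hp), by split_ifs <;> rfl⟩

theorem reach_even (ρ : ℤ × ℤ) (j : ℕ) {p q : ℤ × ℤ} (hp : p ∈ reach S ρ (2 * j))
    (e : p.1 = q.1) (h : BoxVisible S p q) : q ∈ reach S ρ (2 * j) := by
  rcases j with _ | j
  · exact ⟨hp.1.trans e, hp.2.trans_v h hp.1 e⟩
  · replace hp : p ∈ reach S ρ (2 * j + 1 + 1) := hp
    change q ∈ reach S ρ (2 * j + 1 + 1)
    obtain ⟨s, hs, hv, ht⟩ := hp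
    have hodd : ¬ Even (2 * j + 1) := by simp
    rw [if_neg hodd] at ht
    exact ⟨s, hs, hv.trans_v h ht e, by rw [if_neg hodd]; exact ht.trans e⟩

theorem reach_odd (ρ : ℤ × ℤ) (j : ℕ) {p q : ℤ × ℤ} (hp : p ∈ reach S ρ (2 * j + 1))
    (e : p.2 = q.2) (h : BoxVisible S p q) : q ∈ reach S ρ (2 * j + 1) := by
  obtain ⟨s, hs, hv, ht⟩ := hp
  have heven : Even (2 * j) := by simp
  rw [if_pos heven] at ht
  exact ⟨s, hs, hv.trans_h h ht e, by rw [if_pos heven]; exact ht.trans e⟩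

theorem componentRoot_eq {p q : ℤ × ℤ} (h : Aligned S p q) :
    componentRoot S p = componentRoot S q := by
  unfold componentRoot
  rw [Quot.sound h]

theorem componentRoot_eqvGen (p : ℤ × ℤ) : EqvGen (Aligned S) (componentRoot S p) p :=
  Quot.eqvGen_exact (Quot.out_eq _)

theorem componentRoot_idem (p : ℤ × ℤ) :
    componentRoot S (componentRoot S p) = componentRoot S p := by
  unfold componentRoot
  rw [Quot.out_eq]

theorem componentRoot_mem {p : ℤ × ℤ} (hp : p ∈ S) : componentRoot S p ∈ S := by
  have : ∀ a b, EqvGen (Aligned S) a b → (a ∈ S ↔ b ∈ S) := by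
    intro a b h
    induction h with
    | rel a b h => exact ⟨fun _ => h.2.right_mem, fun _ => h.2.left_mem⟩
    | refl => rfl
    | symm _ _ _ ih => exact ih.symm
    | trans _ _ _ _ _ ih ih' => exact ih.trans ih'
  exact (this _ _ (componentRoot_eqvGen p)).2 hp

theorem exists_mem_reach {p : ℤ × ℤ} (hp : p ∈ S) : ∃ k, p ∈ reach S (componentRoot S p) k := by
  have hstep : ∀ ρ a b, Aligned S a b → (∃ k, a ∈ reach S ρ k) → ∃ k, b ∈ reach S ρ k := by
    rintro ρ a b ⟨h1 | h1, h2⟩ ⟨k, hk⟩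
    · exact ⟨2 * k, reach_even ρ k (reach_mono ρ (by omega) hk) h1 h2⟩
    · exact ⟨2 * k + 1, reach_odd ρ k (reach_mono ρ (by omega) hk) h1 h2⟩
  have : ∀ ρ a b, EqvGen (Aligned S) a b → ((∃ k, a ∈ reach S ρ k) ↔ ∃ k, b ∈ reach S ρ k) := by
    intro ρ a b h
    induction h with
    | rel a b h =>
      exact ⟨hstep ρ a b h, hstep ρ b a ⟨h.1.imp Eq.symm Eq.symm, h.2.symm⟩⟩
    | refl => rfl
    | symm _ _ _ ih => exact ih.symm
    | trans _ _ _ _ _ ih ih' => exact ih.trans ih'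
  exact (this _ _ _ (componentRoot_eqvGen p)).1
    ⟨0, rfl, boxVisible_self (componentRoot_mem hp)⟩

/-- The level of a cell in the breadth-first search from the root of its component. -/
noncomputable def searchLevel (S : Set (ℤ × ℤ)) (p : ℤ × ℤ) : ℕ :=
  sInf {k | p ∈ reach S (componentRoot S p) k}

theorem searchLevel_le_iff {p : ℤ × ℤ} (hp : p ∈ S) {k : ℕ} :
    searchLevel S p ≤ k ↔ p ∈ reach S (componentRoot S p) k :=
  ⟨fun h => reach_mono _ h (Nat.sInf_mem (exists_mem_reach hp)), fun h => Nat.sInf_le h⟩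

theorem searchLevel_zero {x y : ℤ} (h : (x, y) ∈ S) (h0 : searchLevel S (x, y) = 0) :
    (componentRoot S (x, y)).1 = x ∧ BoxVisible S (x, y) (componentRoot S (x, y)) := by
  have := (searchLevel_le_iff h).1 h0.le
  exact ⟨this.1, this.2.symm⟩

theorem levelFunction_searchLevel (S : Set (ℤ × ℤ)) :
    LevelFunction S (componentRoot S) (searchLevel S) := by
  have rv : ∀ x y y', BoxVisible S (x, y) (x, y') →
      componentRoot S (x, y) = componentRoot S (x, y') := fun x y y' h =>
    componentRoot_eq ⟨Or.inl rfl, h⟩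
  have rh : ∀ x x' y, BoxVisible S (x, y) (x', y) →
      componentRoot S (x, y) = componentRoot S (x', y) := fun x x' y h =>
    componentRoot_eq ⟨Or.inr rfl, h⟩
  have ev : ∀ j x y y', BoxVisible S (x, y) (x, y') → searchLevel S (x, y) ≤ 2 * j →
      searchLevel S (x, y') ≤ 2 * j := by
    intro j x y y' h h'
    rw [searchLevel_le_iff h.left_mem] at h'
    rw [searchLevel_le_iff h.right_mem, ← rv _ _ _ h]
    exact reach_even _ j h' rfl h
  refine ⟨rv, rh, ev, ?_, ?_, ?_, ?_⟩
  · intro j x x' y h h'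
    rw [searchLevel_le_iff h.left_mem] at h'
    rw [searchLevel_le_iff h.right_mem, ← rh _ _ _ h]
    exact reach_odd _ j h' rfl h
  · intro j x y hS h
    obtain ⟨⟨x', y'⟩, hq, hv, he⟩ := (searchLevel_le_iff hS).1 h.le
    rw [if_pos (by simp)] at he
    simp only at he
    subst he
    refine ⟨x', hv.symm, ?_⟩
    rw [searchLevel_le_iff hv.left_mem, rh _ _ _ hv]
    exact hq
  · intro j x y hS h
    obtain ⟨⟨x', y'⟩, hq, hv, he⟩ := (searchLevel_le_iff hS).1 h.le
    rw [if_neg (by simp)] at he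
    simp only at he
    subst he
    refine ⟨y', hv.symm, ?_⟩
    rw [searchLevel_le_iff hv.left_mem, rv _ _ _ hv]
    exact hq
  · intro x y hS h
    obtain ⟨h1, h2⟩ := searchLevel_zero hS h
    generalize componentRoot S (x, y) = q at *
    obtain ⟨u, v⟩ := q
    simp only at h1
    subst h1
    refine ⟨v, u, h2, boxVisible_self h2.right_mem, rfl, fun i hi hi' => ?_⟩
    obtain rfl : i = u := by omega
    have := ev 0 _ _ _ h2 (by omega)
    omega

/-- The cells of level zero are guarded by the roots, which see each other only if equal. -/
theorem guardable_level_zero (hfin : S.Finite) :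
    ConflictFreeGuardable S {p | p ∈ S ∧ searchLevel S p = 0} 1 := by
  classical
  refine ⟨hfin.toFinset.image (componentRoot S), fun _ => 0, ?_, by simp, ?_⟩
  · intro g hg
    obtain ⟨p, hp, rfl⟩ := Finset.mem_image.1 hg
    rw [Set.Finite.mem_toFinset] at hp
    have hm := componentRoot_mem hp
    refine ⟨hm, Nat.le_zero.1 ((searchLevel_le_iff hm).2 ?_)⟩
    rw [componentRoot_idem]
    exact ⟨rfl, boxVisible_self hm⟩
  · rintro ⟨x, y⟩ ⟨hp, h0⟩
    refine ⟨componentRoot S (x, y), Finset.mem_image_of_mem _ (by simpa using hp),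
      (searchLevel_zero hp h0).2, fun g' hg' hv _ => ?_⟩
    obtain ⟨q, -, rfl⟩ := Finset.mem_image.1 hg'
    have hL := levelFunction_searchLevel S
    rw [← componentRoot_idem q]
    generalize componentRoot S q = g at *
    obtain ⟨u, v⟩ := g
    rw [hL.root_h x u y (hv.mono le_rfl le_rfl (by simp) (by simp)),
      hL.root_v u y v (hv.mono (by simp) (by simp) le_rfl le_rfl)]

/-- The discrete form of the theorem: a finite set of lattice cells with connected complement has a
conflict-free guarding whose number of colors is doubly logarithmic in the number of cells. -/
theorem CoConnected.guardable (hS : CoConnected S) (hfin : S.Finite) :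
    ConflictFreeGuardable S S (8 * (Nat.log 2 (Nat.log 2 S.ncard + 1) + 1)) := by
  have hL := levelFunction_searchLevel S
  let e : ℤ × ℤ → ℤ × ℤ := fun p => (p.2, p.1)
  have hpre : {p : ℤ × ℤ | (p.2, p.1) ∈ S} = e '' S := by
    ext p
    constructor
    · intro h
      exact ⟨e p, h, rfl⟩
    · rintro ⟨q, hq, rfl⟩
      exact hq
  have hfin' : {p : ℤ × ℤ | (p.2, p.1) ∈ S}.Finite := by
    rw [hpre]
    exact hfin.image e
  have hcard : {p : ℤ × ℤ | (p.2, p.1) ∈ S}.ncard = S.ncard := by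
    rw [hpre]
    exact Set.ncard_image_of_injective _ Prod.swap_injective
  have hodd := hL.guardable_odd hS hfin
  have heven := ((hL.swap fun x y h h' => searchLevel_zero h h').guardable_odd hS.swap
    hfin').transport (S := S) (e := e) (fun p => rfl)
    fun p q => by rw [boxVisible_swap]
  rw [hcard] at heven
  have h1 := hodd.union heven ?_
  · have h2 := h1.union ((guardable_level_zero hfin).mono (by omega)) ?_
    · refine cast ?_ h2
      congr 1
      · ext p
        simp only [Set.mem_union, Set.mem_ofPred_eq, e]
        constructor
        · rintro ((h | h) | h) <;> exact h.1
        · intro h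
          have : searchLevel S p % 2 = 1 ∨ (searchLevel S p - 1) % 2 = 1 ∨ searchLevel S p = 0 := by
            omega
          tauto
      · ring
    · rw [Set.disjoint_left]
      rintro p (⟨-, h⟩ | ⟨-, h⟩) ⟨-, h'⟩
      · omega
      · simp only [e] at h
        change (searchLevel S p - 1) % 2 = 1 at h
        omega
  · rw [Set.disjoint_left]
    rintro p ⟨-, h⟩ ⟨-, h'⟩
    change (searchLevel S p - 1) % 2 = 1 at h'
    omega

end Search

/-! ### The exterior of the polygon is connected -/

/-- An open set is connected if its frontier is connected and it is connected near each point of its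
frontier: a component of the set touches a subset of the frontier that is open and closed. -/
theorem isPreconnected_of_frontier {X : Type*} [TopologicalSpace X] [PreconnectedSpace X]
    {U : Set X} (hU : IsOpen U) (hK : IsPreconnected (frontier U))
    (hloc : ∀ x ∈ frontier U, ∃ N ∈ 𝓝 x, IsPreconnected (N ∩ U)) : IsPreconnected U := by
  intro u v hu hv huv hUu hUv
  by_contra hcon
  have hdisj : ∀ z, z ∈ U → z ∈ u → z ∈ v → False := fun z h1 h2 h3 => hcon ⟨z, h1, h2, h3⟩
  have hcov : frontier U ⊆ closure (U ∩ u) ∪ closure (U ∩ v) := by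
    rw [← closure_union, ← Set.inter_union_distrib_left, Set.inter_eq_left.2 huv]
    exact frontier_subset_closure
  -- a part that does not touch the frontier is open and closed in the whole space
  have hmeet : ∀ u v : Set X, IsOpen u → IsOpen v → U ⊆ u ∪ v →
      (∀ z, z ∈ U → z ∈ u → z ∈ v → False) →
      (U ∩ u).Nonempty → (U ∩ v).Nonempty → (frontier U ∩ closure (U ∩ u)).Nonempty := by
    intro u v hu hv huv hdisj hUu hUv
    by_contra hne
    have hcl : IsClopen (U ∩ u) := by
      refine ⟨?_, hU.inter hu⟩
      rw [← closure_subset_iff_isClosed]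
      intro z hz
      have hzU : z ∈ U := by
        by_contra hzU
        refine hne ⟨z, ⟨closure_mono Set.inter_subset_left hz, ?_⟩, hz⟩
        rwa [hU.interior_eq]
      rcases huv hzU with h | h
      · exact ⟨hzU, h⟩
      · obtain ⟨w, hw1, hw2⟩ := mem_closure_iff.1 hz _ (hU.inter hv) ⟨hzU, h⟩
        exact (hdisj w hw2.1 hw2.2 hw1.2).elim
    rcases isClopen_iff.1 hcl with h | h
    · rw [h] at hUu
      exact Set.not_nonempty_empty hUu
    · obtain ⟨z, hz1, hz2⟩ := hUv
      have : z ∈ U ∩ u := h ▸ Set.mem_univ z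
      exact hdisj z hz1 this.2 hz2
  have h1 := hmeet u v hu hv huv hdisj hUu hUv
  have h2 := hmeet v u hv hu (by rwa [Set.union_comm]) (fun z a b c => hdisj z a c b) hUv hUu
  obtain ⟨x, hx, hx1, hx2⟩ := isPreconnected_closed_iff.1 hK _ _ isClosed_closure isClosed_closure
    hcov h1 h2
  obtain ⟨N, hN, hNU⟩ := hloc x hx
  have hmem : ∀ w : Set X, x ∈ closure (U ∩ w) → (N ∩ U ∩ w).Nonempty := by
    intro w hw
    obtain ⟨z, hz1, hz2⟩ := mem_closure_iff_nhds.1 hw N hN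
    exact ⟨z, ⟨hz1, hz2.1⟩, hz2.2⟩
  obtain ⟨z, hz1, hz2, hz3⟩ := hNU u v hu hv (Set.inter_subset_right.trans huv) (hmem u hx1)
    (hmem v hx2)
  exact hdisj z hz1.2 hz2 hz3

theorem IsPreconnected.subset_or_subset_compl {X : Type*} [TopologicalSpace X] {P Q : Set X}
    (hQ : IsPreconnected Q) (hd : ∀ z ∈ Q, z ∉ frontier P) (hP : IsClosed P) :
    Q ⊆ P ∨ Q ⊆ Pᶜ := by
  have hcov : Q ⊆ interior P ∪ Pᶜ := by
    intro z hz
    by_cases hzP : z ∈ P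
    · left
      by_contra hzi
      exact hd z hz ⟨subset_closure hzP, hzi⟩
    · exact Or.inr hzP
  rcases hQ.subset_or_subset isOpen_interior hP.isOpen_compl
    (Set.disjoint_left.2 fun z h h' => h' (interior_subset h)) hcov with h | h
  · exact Or.inl (h.trans interior_subset)
  · exact Or.inr h

/-- If the frontier of a regular closed set divides a neighborhood into two connected pieces, then
at most one of them is outside the set. -/
theorem isPreconnected_inter_compl {P N Q₁ Q₂ : Set (ℝ × ℝ)} {x : ℝ × ℝ} (hP : IsClosed P)
    (hreg : closure (interior P) = P) (hxP : x ∈ P) (hN : IsOpen N) (hx : x ∈ N)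
    (h1 : IsPreconnected Q₁) (h2 : IsPreconnected Q₂) (hQ1 : Q₁ ⊆ N \ frontier P)
    (hQ2 : Q₂ ⊆ N \ frontier P) (hcov : N \ frontier P ⊆ Q₁ ∪ Q₂)
    (hdense : ∀ z ∈ N, z.1 ≠ x.1 → z.2 ≠ x.2 → z ∈ Q₁ ∪ Q₂) : IsPreconnected (N ∩ Pᶜ) := by
  have hsub : N ∩ Pᶜ ⊆ Q₁ ∪ Q₂ := fun z hz => hcov ⟨hz.1, fun h => hz.2 (hP.frontier_subset h)⟩
  have key : ∀ {Q Q' : Set (ℝ × ℝ)}, Q ⊆ P → Q' ⊆ Pᶜ → Q' ⊆ N → N ∩ Pᶜ ⊆ Q ∪ Q' → N ∩ Pᶜ = Q' := by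
    intro Q Q' h h' h'' hs
    refine Set.Subset.antisymm (fun z hz => ?_) fun z hz => ⟨h'' hz, h' hz⟩
    rcases hs hz with hz' | hz'
    · exact (hz.2 (h hz')).elim
    · exact hz'
  rcases h1.subset_or_subset_compl (fun z hz => (hQ1 hz).2) hP with a | a <;>
    rcases h2.subset_or_subset_compl (fun z hz => (hQ2 hz).2) hP with b | b
  · have : N ∩ Pᶜ = ∅ := by
      ext z
      simp only [Set.mem_empty_iff_false, iff_false]
      intro hz
      rcases hsub hz with h | h
      · exact hz.2 (a h)
      · exact hz.2 (b h)
    rw [this]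
    exact isPreconnected_empty
  · rw [key a b (fun z hz => (hQ2 hz).1) hsub]
    exact h2
  · rw [key b a (fun z hz => (hQ1 hz).1) (by rwa [Set.union_comm])]
    exact h1
  · exfalso
    rw [← hreg] at hxP
    obtain ⟨w, hw⟩ := mem_closure_iff.1 hxP N hN hx
    have hD : Dense ({x.1}ᶜ ×ˢ {x.2}ᶜ : Set (ℝ × ℝ)) :=
      (dense_compl_singleton _).prod (dense_compl_singleton _)
    obtain ⟨z, hz1, hz2⟩ := hD.inter_open_nonempty _ (hN.inter isOpen_interior) ⟨w, hw⟩
    rcases hdense z hz1.1 hz2.1 hz2.2 with h | h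
    · exact a h (interior_subset hz1.2)
    · exact b h (interior_subset hz1.2)

/-- The part of the interval of radius `r` about `c` on the side given by the sign of `s`. -/
def sideInterval (c r s : ℝ) : Set ℝ := {t | |t - c| < r ∧ 0 < s * (t - c)}

theorem convex_sideInterval (c r s : ℝ) : Convex ℝ (sideInterval c r s) := by
  rw [convex_iff_ordConnected]
  refine ⟨fun a ha b hb t ht => ?_⟩
  obtain ⟨ha1, ha2⟩ := ha
  obtain ⟨hb1, hb2⟩ := hb
  rw [abs_lt] at ha1 hb1
  refine ⟨abs_lt.2 ⟨by linarith [ht.1], by linarith [ht.2]⟩, ?_⟩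
  rcases le_total 0 s with hs | hs
  · nlinarith [ht.1, ht.2]
  · nlinarith [ht.1, ht.2]

theorem sideInterval_nonempty {c r s : ℝ} (hr : 0 < r) (hs : s ≠ 0) :
    (sideInterval c r s).Nonempty := by
  rcases lt_or_gt_of_ne hs with h | h
  · refine ⟨c - r / 2, ?_, by nlinarith⟩
    rw [abs_lt]
    constructor <;> linarith
  · refine ⟨c + r / 2, ?_, by nlinarith⟩
    rw [abs_lt]
    constructor <;> linarith

theorem convex_interval (c r : ℝ) : Convex ℝ {t : ℝ | |t - c| < r} := by
  have : {t : ℝ | |t - c| < r} = Metric.ball c r := by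
    ext t
    simp [Real.dist_eq]
  rw [this]
  exact convex_ball c r

/-- The open square of radius `r` about `x`. -/
def openSquare (x : ℝ × ℝ) (r : ℝ) : Set (ℝ × ℝ) := {z | |z.1 - x.1| < r ∧ |z.2 - x.2| < r}

theorem openSquare_eq_ball (x : ℝ × ℝ) (r : ℝ) : openSquare x r = Metric.ball x r := by
  ext z
  simp [openSquare, Prod.dist_eq, Real.dist_eq]

theorem isPreconnected_near_horizontal {P : Set (ℝ × ℝ)} {x : ℝ × ℝ} {r : ℝ} (hP : IsClosed P)
    (hreg : closure (interior P) = P) (hxP : x ∈ P) (hr : 0 < r)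
    (h : ∀ z ∈ openSquare x r, (z ∈ frontier P ↔ z.2 = x.2)) :
    IsPreconnected (openSquare x r ∩ Pᶜ) := by
  have hx : x ∈ openSquare x r := by simp [openSquare, hr]
  have hsgn : ∀ z : ℝ × ℝ, z.2 ≠ x.2 → 0 < 1 * (z.2 - x.2) ∨ 0 < -1 * (z.2 - x.2) := by
    intro z hz
    rcases lt_or_gt_of_ne hz with h | h
    · right; linarith
    · left; linarith
  refine isPreconnected_inter_compl (x := x) (Q₁ := {t : ℝ | |t - x.1| < r} ×ˢ sideInterval x.2 r 1)
    (Q₂ := {t : ℝ | |t - x.1| < r} ×ˢ sideInterval x.2 r (-1)) hP hreg hxP ?_ hx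
    ((convex_interval _ _).prod (convex_sideInterval _ _ _)).isPreconnected
    ((convex_interval _ _).prod (convex_sideInterval _ _ _)).isPreconnected ?_ ?_ ?_ ?_
  · rw [openSquare_eq_ball]
    exact Metric.isOpen_ball
  · rintro z ⟨h1, h2, h3⟩
    refine ⟨⟨h1, h2⟩, fun hz => ?_⟩
    rw [h z ⟨h1, h2⟩] at hz
    rw [hz] at h3
    simp at h3
  · rintro z ⟨h1, h2, h3⟩
    refine ⟨⟨h1, h2⟩, fun hz => ?_⟩
    rw [h z ⟨h1, h2⟩] at hz
    rw [hz] at h3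
    simp at h3
  · rintro z ⟨hz, hz'⟩
    rw [h z hz] at hz'
    rcases hsgn z hz' with h | h
    · exact Or.inl ⟨hz.1, hz.2, h⟩
    · exact Or.inr ⟨hz.1, hz.2, h⟩
  · intro z hz _ hz'
    rcases hsgn z hz' with h | h
    · exact Or.inl ⟨hz.1, hz.2, h⟩
    · exact Or.inr ⟨hz.1, hz.2, h⟩

theorem isPreconnected_near_vertical {P : Set (ℝ × ℝ)} {x : ℝ × ℝ} {r : ℝ} (hP : IsClosed P)
    (hreg : closure (interior P) = P) (hxP : x ∈ P) (hr : 0 < r)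
    (h : ∀ z ∈ openSquare x r, (z ∈ frontier P ↔ z.1 = x.1)) :
    IsPreconnected (openSquare x r ∩ Pᶜ) := by
  have hx : x ∈ openSquare x r := by simp [openSquare, hr]
  have hsgn : ∀ z : ℝ × ℝ, z.1 ≠ x.1 → 0 < 1 * (z.1 - x.1) ∨ 0 < -1 * (z.1 - x.1) := by
    intro z hz
    rcases lt_or_gt_of_ne hz with h | h
    · right; linarith
    · left; linarith
  refine isPreconnected_inter_compl (x := x) (Q₁ := sideInterval x.1 r 1 ×ˢ {t : ℝ | |t - x.2| < r})
    (Q₂ := sideInterval x.1 r (-1) ×ˢ {t : ℝ | |t - x.2| < r}) hP hreg hxP ?_ hx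
    ((convex_sideInterval _ _ _).prod (convex_interval _ _)).isPreconnected
    ((convex_sideInterval _ _ _).prod (convex_interval _ _)).isPreconnected ?_ ?_ ?_ ?_
  · rw [openSquare_eq_ball]
    exact Metric.isOpen_ball
  · rintro z ⟨⟨h1, h3⟩, h2⟩
    refine ⟨⟨h1, h2⟩, fun hz => ?_⟩
    rw [h z ⟨h1, h2⟩] at hz
    rw [hz] at h3
    simp at h3
  · rintro z ⟨⟨h1, h3⟩, h2⟩
    refine ⟨⟨h1, h2⟩, fun hz => ?_⟩
    rw [h z ⟨h1, h2⟩] at hz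
    rw [hz] at h3
    simp at h3
  · rintro z ⟨hz, hz'⟩
    rw [h z hz] at hz'
    rcases hsgn z hz' with h | h
    · exact Or.inl ⟨⟨hz.1, h⟩, hz.2⟩
    · exact Or.inr ⟨⟨hz.1, h⟩, hz.2⟩
  · intro z hz hz' _
    rcases hsgn z hz' with h | h
    · exact Or.inl ⟨⟨hz.1, h⟩, hz.2⟩
    · exact Or.inr ⟨⟨hz.1, h⟩, hz.2⟩

/-- At a corner the frontier separates a quadrant from the union of two overlapping half squares. -/
theorem isPreconnected_near_corner {P : Set (ℝ × ℝ)} {x : ℝ × ℝ} {r s t : ℝ} (hP : IsClosed P)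
    (hreg : closure (interior P) = P) (hxP : x ∈ P) (hr : 0 < r) (hs : s ≠ 0) (ht : t ≠ 0)
    (h : ∀ z ∈ openSquare x r, (z ∈ frontier P ↔
      (z.2 = x.2 ∧ 0 ≤ s * (z.1 - x.1)) ∨ (z.1 = x.1 ∧ 0 ≤ t * (z.2 - x.2)))) :
    IsPreconnected (openSquare x r ∩ Pᶜ) := by
  have hx : x ∈ openSquare x r := by simp [openSquare, hr]
  have hcov : ∀ z ∈ openSquare x r, ¬ ((z.2 = x.2 ∧ 0 ≤ s * (z.1 - x.1)) ∨
      (z.1 = x.1 ∧ 0 ≤ t * (z.2 - x.2))) → z ∈ sideInterval x.1 r s ×ˢ sideInterval x.2 r t ∪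
      (sideInterval x.1 r (-s) ×ˢ {t : ℝ | |t - x.2| < r} ∪
        {t : ℝ | |t - x.1| < r} ×ˢ sideInterval x.2 r (-t)) := by
    rintro z ⟨hz1, hz2⟩ hz
    by_cases h1 : 0 < -s * (z.1 - x.1)
    · exact Or.inr (Or.inl ⟨⟨hz1, h1⟩, hz2⟩)
    by_cases h2 : 0 < -t * (z.2 - x.2)
    · exact Or.inr (Or.inr ⟨hz1, ⟨hz2, h2⟩⟩)
    have h1' : 0 ≤ s * (z.1 - x.1) := by linarith
    have h2' : 0 ≤ t * (z.2 - x.2) := by linarith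
    push Not at hz
    refine Or.inl ⟨⟨hz1, lt_of_le_of_ne h1' fun h0 => ?_⟩, ⟨hz2, lt_of_le_of_ne h2' fun h0 => ?_⟩⟩
    · rcases mul_eq_zero.1 h0.symm with h | h
      · exact hs h
      · exact absurd (hz.2 (by linarith)) (not_lt.2 h2')
    · rcases mul_eq_zero.1 h0.symm with h | h
      · exact ht h
      · exact absurd (hz.1 (by linarith)) (not_lt.2 h1')
  have hQ2 : IsPreconnected (sideInterval x.1 r (-s) ×ˢ {t : ℝ | |t - x.2| < r} ∪
      {t : ℝ | |t - x.1| < r} ×ˢ sideInterval x.2 r (-t)) := by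
    obtain ⟨a, ha⟩ := sideInterval_nonempty (c := x.1) hr (neg_ne_zero.2 hs)
    obtain ⟨b, hb⟩ := sideInterval_nonempty (c := x.2) hr (neg_ne_zero.2 ht)
    exact IsPreconnected.union (a, b) ⟨ha, hb.1⟩ ⟨ha.1, hb⟩
      ((convex_sideInterval _ _ _).prod (convex_interval _ _)).isPreconnected
      ((convex_interval _ _).prod (convex_sideInterval _ _ _)).isPreconnected
  refine isPreconnected_inter_compl (x := x) hP hreg hxP ?_ hx
    ((convex_sideInterval x.1 r s).prod (convex_sideInterval x.2 r t)).isPreconnected hQ2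
    ?_ ?_ ?_ ?_
  · rw [openSquare_eq_ball]
    exact Metric.isOpen_ball
  · rintro z ⟨⟨h1, h2⟩, h3, h4⟩
    refine ⟨⟨h1, h3⟩, fun hz => ?_⟩
    rw [h z ⟨h1, h3⟩] at hz
    rcases hz with ⟨hz, -⟩ | ⟨hz, -⟩
    · rw [hz] at h4; simp at h4
    · rw [hz] at h2; simp at h2
  · rintro z (⟨⟨h1, h2⟩, h3⟩ | ⟨h1, h3, h4⟩)
    · refine ⟨⟨h1, h3⟩, fun hz => ?_⟩
      rw [h z ⟨h1, h3⟩] at hz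
      rcases hz with ⟨-, hz⟩ | ⟨hz, -⟩
      · linarith
      · rw [hz] at h2; simp at h2
    · refine ⟨⟨h1, h3⟩, fun hz => ?_⟩
      rw [h z ⟨h1, h3⟩] at hz
      rcases hz with ⟨hz, -⟩ | ⟨-, hz⟩
      · rw [hz] at h4; simp at h4
      · linarith
  · rintro z ⟨hz, hz'⟩
    exact hcov z hz (by rwa [← h z hz])
  · intro z hz h1 h2
    refine hcov z hz ?_
    rintro (⟨h3, -⟩ | ⟨h3, -⟩)
    · exact h2 h3
    · exact h1 h3

theorem mem_segment_horizontal {p q z : ℝ × ℝ} (h : p.2 = q.2) :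
    z ∈ segment ℝ p q ↔ z.2 = p.2 ∧ z.1 ∈ Set.uIcc p.1 q.1 := by
  obtain ⟨a, b⟩ := p
  obtain ⟨c, d⟩ := q
  obtain ⟨u, v⟩ := z
  simp only at h
  subst h
  rw [← Prod.image_mk_segment_left, segment_eq_uIcc]
  simp only [Set.mem_image, Prod.mk.injEq]
  constructor
  · rintro ⟨w, hw, rfl, rfl⟩
    exact ⟨rfl, hw⟩
  · rintro ⟨rfl, hw⟩
    exact ⟨u, hw, rfl, rfl⟩

theorem mem_segment_vertical {p q z : ℝ × ℝ} (h : p.1 = q.1) :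
    z ∈ segment ℝ p q ↔ z.1 = p.1 ∧ z.2 ∈ Set.uIcc p.2 q.2 := by
  obtain ⟨a, b⟩ := p
  obtain ⟨c, d⟩ := q
  obtain ⟨u, v⟩ := z
  simp only at h
  subst h
  rw [← Prod.image_mk_segment_right, segment_eq_uIcc]
  simp only [Set.mem_image, Prod.mk.injEq]
  constructor
  · rintro ⟨w, hw, rfl, rfl⟩
    exact ⟨rfl, hw⟩
  · rintro ⟨rfl, hw⟩
    exact ⟨v, hw, rfl, rfl⟩

/-- Near its end point `b`, the interval between `a` and `b` is a half line. -/
theorem mem_uIcc_near {a b t : ℝ} (h : |t - b| < |a - b|) :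
    t ∈ Set.uIcc a b ↔ 0 ≤ (a - b) * (t - b) := by
  rw [Set.mem_uIcc]
  rcases le_total a b with hab | hab
  · rw [abs_of_nonpos (by linarith : a - b ≤ 0), abs_lt] at h
    constructor
    · rintro (h1 | h1) <;> nlinarith
    · intro h1
      refine Or.inl ⟨by linarith, ?_⟩
      by_contra hcon
      nlinarith
  · rw [abs_of_nonneg (by linarith : 0 ≤ a - b), abs_lt] at h
    constructor
    · rintro (h1 | h1) <;> nlinarith
    · intro h1
      refine Or.inr ⟨?_, by linarith⟩
      by_contra hcon
      nlinarith

/-- Near an inner point `c`, the interval between `a` and `b` is the whole line. -/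
theorem mem_uIcc_of_near {a b c t : ℝ} (hc : c ∈ Set.uIcc a b) (h1 : |t - c| < |a - c|)
    (h2 : |t - c| < |b - c|) : t ∈ Set.uIcc a b := by
  rw [Set.mem_uIcc] at hc ⊢
  rcases hc with ⟨ha, hb⟩ | ⟨ha, hb⟩
  · rw [abs_of_nonpos (by linarith : a - c ≤ 0), abs_lt] at h1
    rw [abs_of_nonneg (by linarith : 0 ≤ b - c), abs_lt] at h2
    exact Or.inl ⟨by linarith, by linarith⟩
  · rw [abs_of_nonneg (by linarith : 0 ≤ a - c), abs_lt] at h1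
    rw [abs_of_nonpos (by linarith : b - c ≤ 0), abs_lt] at h2
    exact Or.inr ⟨by linarith, by linarith⟩

namespace SimpleOrthogonalPolygon

variable {n : ℕ} (P : SimpleOrthogonalPolygon n)

include P in
theorem neZero : NeZero n := ⟨by have := P.four_le; omega⟩

/-- The edge from `vertex i` to `vertex (i + 1)`. -/
def edge (i : ZMod n) : Set (ℝ × ℝ) := segment ℝ (P.vertex i) (P.vertex (i + 1))

theorem isClosed_edge (i : ZMod n) : IsClosed (P.edge i) := by
  have : (P.edge i) = segment ℝ (P.vertex i) (P.vertex (i + 1)) := rfl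
  rw [this, ← convexHull_pair]
  exact ((Set.toFinite _).isCompact_convexHull ℝ).isClosed

theorem horizontal_or_vertical (i : ZMod n) :
    (P.vertex i).2 = (P.vertex (i + 1)).2 ∨ (P.vertex i).1 = (P.vertex (i + 1)).1 :=
  (P.alternating i).imp And.left And.left

theorem isPreconnected_frontier : IsPreconnected (frontier P.region) := by
  have := P.neZero
  rw [P.frontier_region]
  refine IsPreconnected.iUnion_of_reflTransGen (fun i => (convex_segment _ _).isPreconnected)
    fun i j => ?_
  have key : ∀ k : ℕ, ReflTransGen (fun i j : ZMod n =>
      (segment ℝ (P.vertex i) (P.vertex (i + 1)) ∩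
        segment ℝ (P.vertex j) (P.vertex (j + 1))).Nonempty) i (i + k) := by
    intro k
    induction k with
    | zero => simpa using ReflTransGen.refl
    | succ k ih =>
      refine ih.tail ⟨P.vertex (i + k + 1), right_mem_segment _ _ _, ?_⟩
      have : i + ((k + 1 : ℕ) : ZMod n) = i + k + 1 := by push_cast; ring
      rw [this]
      exact left_mem_segment _ _ _
  have := key (j - i).val
  rwa [ZMod.natCast_zmod_val, add_sub_cancel] at this

/-- Near a point that lies on no edge outside `T`, the frontier consists of the edges in `T`. -/
theorem exists_radius (T : Set (ZMod n)) (x : ℝ × ℝ) (hx : ∀ j, j ∉ T → x ∉ P.edge j) {ε : ℝ}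
    (hε : 0 < ε) : ∃ r, 0 < r ∧ r ≤ ε ∧ ∀ z ∈ openSquare x r,
      (z ∈ frontier P.region ↔ ∃ j ∈ T, z ∈ P.edge j) := by
  have := P.neZero
  have hcl : IsClosed (⋃ j ∈ Tᶜ, P.edge j) :=
    (Set.toFinite (Tᶜ)).isClosed_biUnion fun j _ => P.isClosed_edge j
  have hx' : x ∈ (⋃ j ∈ Tᶜ, P.edge j)ᶜ := by
    simpa using hx
  obtain ⟨r, hr, hball⟩ := Metric.isOpen_iff.1 hcl.isOpen_compl x hx'
  refine ⟨min r ε, lt_min hr hε, min_le_right _ _, fun z hz => ?_⟩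
  rw [P.frontier_region]
  constructor
  · intro h
    obtain ⟨j, hj⟩ := Set.mem_iUnion.1 h
    by_contra hcon
    push Not at hcon
    have hz' : z ∈ Metric.ball x r := by
      rw [← openSquare_eq_ball]
      exact ⟨hz.1.trans_le (min_le_left _ _), hz.2.trans_le (min_le_left _ _)⟩
    have := hball hz'
    simp only [Set.mem_compl_iff, Set.mem_iUnion, not_exists] at this
    exact this j (fun hjT => hcon j hjT hj) hj
  · rintro ⟨j, -, hj⟩
    exact Set.mem_iUnion.2 ⟨j, hj⟩

theorem exists_isPreconnected_near {x : ℝ × ℝ} (hx : x ∈ frontier P.region) :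
    ∃ N ∈ 𝓝 x, IsPreconnected (N ∩ P.regionᶜ) := by
  have := P.neZero
  have hcl := P.isCompact_region.isClosed
  have hreg := P.closure_interior_region
  have hxP : x ∈ P.region := hcl.frontier_subset hx
  suffices ∃ r, 0 < r ∧ IsPreconnected (openSquare x r ∩ P.regionᶜ) by
    obtain ⟨r, hr, h⟩ := this
    refine ⟨openSquare x r, ?_, h⟩
    rw [openSquare_eq_ball]
    exact Metric.ball_mem_nhds x hr
  have hsucc : ∀ i : ZMod n, i ≠ i + 1 := by
    intro i h
    have := P.four_le
    have : (1 : ZMod n) = 0 := by simpa using h.symm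
    have : Fact (1 < n) := ⟨by omega⟩
    exact one_ne_zero ‹(1 : ZMod n) = 0›
  by_cases hv : ∃ k, x = P.vertex k
  · obtain ⟨k, hk⟩ := hv
    obtain ⟨i, rfl⟩ : ∃ i, k = i + 1 := ⟨k - 1, by ring⟩
    have hne : ∀ j, j ∉ ({i, i + 1} : Set (ZMod n)) → x ∉ P.edge j := by
      intro j hj hxj
      simp only [Set.mem_insert_iff, Set.mem_singleton_iff, not_or] at hj
      have h1 := P.simple j i hj.1 ⟨hxj, hk ▸ right_mem_segment ℝ _ _⟩
      rcases h1.1 with h | h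
      · exact hj.2 (P.vertex_injective (h.symm.trans hk))
      · rw [Set.mem_singleton_iff] at h
        exact hj.1 (add_right_cancel (P.vertex_injective (h.symm.trans hk)))
    have e2 : i + 1 + 1 = i + 2 := by ring
    have n1 : P.vertex i ≠ P.vertex (i + 1) := fun h => hsucc i (P.vertex_injective h)
    have n2 : P.vertex (i + 1) ≠ P.vertex (i + 2) := fun h =>
      hsucc (i + 1) (e2 ▸ P.vertex_injective h)
    rcases P.alternating i with ⟨h1, h2⟩ | ⟨h1, h2⟩
    · have d1 : (P.vertex i).1 - x.1 ≠ 0 := by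
        rw [hk, sub_ne_zero]
        exact fun h => n1 (Prod.ext h h1)
      have d2 : (P.vertex (i + 2)).2 - x.2 ≠ 0 := by
        rw [hk, sub_ne_zero]
        exact fun h => n2 (Prod.ext h2 h.symm)
      obtain ⟨r, hr, hrle, hfr⟩ := P.exists_radius _ x hne (lt_min (abs_pos.2 d1) (abs_pos.2 d2))
      refine ⟨r, hr, isPreconnected_near_corner hcl hreg hxP hr d1 d2 fun z hz => ?_⟩
      rw [hfr z hz]
      simp only [Set.mem_insert_iff, Set.mem_singleton_iff, exists_eq_or_imp, exists_eq_left, edge]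
      rw [e2, mem_segment_horizontal h1, mem_segment_vertical h2, h1, ← hk, Set.uIcc_comm x.2,
        mem_uIcc_near (hz.1.trans_le (hrle.trans (min_le_left _ _))),
        mem_uIcc_near (hz.2.trans_le (hrle.trans (min_le_right _ _)))]
    · have d1 : (P.vertex (i + 2)).1 - x.1 ≠ 0 := by
        rw [hk, sub_ne_zero]
        exact fun h => n2 (Prod.ext h.symm h2)
      have d2 : (P.vertex i).2 - x.2 ≠ 0 := by
        rw [hk, sub_ne_zero]
        exact fun h => n1 (Prod.ext h1 h)
      obtain ⟨r, hr, hrle, hfr⟩ := P.exists_radius _ x hne (lt_min (abs_pos.2 d1) (abs_pos.2 d2))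
      refine ⟨r, hr, isPreconnected_near_corner hcl hreg hxP hr d1 d2 fun z hz => ?_⟩
      rw [hfr z hz]
      simp only [Set.mem_insert_iff, Set.mem_singleton_iff, exists_eq_or_imp, exists_eq_left, edge]
      rw [e2, mem_segment_vertical h1, mem_segment_horizontal h2, h1, ← hk, Set.uIcc_comm x.1,
        mem_uIcc_near (hz.1.trans_le (hrle.trans (min_le_left _ _))),
        mem_uIcc_near (hz.2.trans_le (hrle.trans (min_le_right _ _))), or_comm]
  · obtain ⟨i, hi⟩ : ∃ i, x ∈ P.edge i := by
      rw [P.frontier_region] at hx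
      exact Set.mem_iUnion.1 hx
    push Not at hv
    have hne : ∀ j, j ∉ ({i} : Set (ZMod n)) → x ∉ P.edge j := by
      intro j hj hxj
      rcases (P.simple j i hj ⟨hxj, hi⟩).1 with h | h
      · exact hv _ h
      · exact hv _ h
    have n1 := hv i
    have n2 := hv (i + 1)
    rcases P.horizontal_or_vertical i with h1 | h1
    · have hx2 := (mem_segment_horizontal h1).1 hi
      have d1 : (P.vertex i).1 - x.1 ≠ 0 := sub_ne_zero.2 fun h => n1 (Prod.ext h.symm hx2.1)
      have d2 : (P.vertex (i + 1)).1 - x.1 ≠ 0 :=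
        sub_ne_zero.2 fun h => n2 (Prod.ext h.symm (hx2.1.trans h1))
      obtain ⟨r, hr, hrle, hfr⟩ := P.exists_radius _ x hne (lt_min (abs_pos.2 d1) (abs_pos.2 d2))
      refine ⟨r, hr, isPreconnected_near_horizontal hcl hreg hxP hr fun z hz => ?_⟩
      rw [hfr z hz]
      simp only [Set.mem_singleton_iff, exists_eq_left, edge]
      rw [mem_segment_horizontal h1, hx2.1]
      exact and_iff_left (mem_uIcc_of_near hx2.2 (hz.1.trans_le (hrle.trans (min_le_left _ _)))
        (hz.1.trans_le (hrle.trans (min_le_right _ _))))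
    · have hx2 := (mem_segment_vertical h1).1 hi
      have d1 : (P.vertex i).2 - x.2 ≠ 0 := sub_ne_zero.2 fun h => n1 (Prod.ext hx2.1 h.symm)
      have d2 : (P.vertex (i + 1)).2 - x.2 ≠ 0 :=
        sub_ne_zero.2 fun h => n2 (Prod.ext (hx2.1.trans h1) h.symm)
      obtain ⟨r, hr, hrle, hfr⟩ := P.exists_radius _ x hne (lt_min (abs_pos.2 d1) (abs_pos.2 d2))
      refine ⟨r, hr, isPreconnected_near_vertical hcl hreg hxP hr fun z hz => ?_⟩
      rw [hfr z hz]
      simp only [Set.mem_singleton_iff, exists_eq_left, edge]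
      rw [mem_segment_vertical h1, hx2.1]
      exact and_iff_left (mem_uIcc_of_near hx2.2 (hz.2.trans_le (hrle.trans (min_le_left _ _)))
        (hz.2.trans_le (hrle.trans (min_le_right _ _))))

/-- The exterior of the polygon is connected. -/
theorem isPreconnected_compl : IsPreconnected P.regionᶜ := by
  refine isPreconnected_of_frontier P.isCompact_region.isClosed.isOpen_compl ?_ fun x hx => ?_
  · rw [frontier_compl]
    exact P.isPreconnected_frontier
  · rw [frontier_compl] at hx
    exact P.exists_isPreconnected_near hx

end SimpleOrthogonalPolygon

/-! ### The grid of vertex coordinates -/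

/-- A property that is locally constant on a preconnected set is constant on it. -/
theorem IsPreconnected.iff_of_locally {X : Type*} [TopologicalSpace X] {s : Set X}
    (hs : IsPreconnected s) {p : X → Prop} (hp : ∀ x ∈ s, ∀ᶠ y in 𝓝[s] x, (p y ↔ p x)) {x y : X}
    (hx : x ∈ s) (hy : y ∈ s) : p x ↔ p y := by
  classical
  have hc : ContinuousOn (fun x => decide (p x)) s := by
    intro x hx
    rw [ContinuousWithinAt, nhds_discrete, Filter.tendsto_pure]
    filter_upwards [hp x hx] with y hy
    simp [hy]
  have := hs.constant hc hx hy
  simpa using this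

/-- The position of `t` relative to the finite set `Z`: the number of elements below `t` minus the
number of elements above `t`. -/
noncomputable def gridIndex (Z : Finset ℝ) (t : ℝ) : ℤ :=
  ∑ a ∈ Z, if a < t then 1 else if t < a then -1 else 0

section Grid

variable {Z : Finset ℝ}

theorem gridIndex_mono : Monotone (gridIndex Z) := by
  intro s t hst
  refine Finset.sum_le_sum fun a _ => ?_
  split_ifs <;> first | omega | (exfalso; linarith)

theorem gridIndex_lt {s t a : ℝ} (ha : a ∈ Z) (hst : s < t) (h : a = s ∨ a = t) :
    gridIndex Z s < gridIndex Z t := by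
  refine Finset.sum_lt_sum (fun b _ => ?_) ⟨a, ha, ?_⟩
  · split_ifs <;> first | omega | (exfalso; linarith)
  · rcases h with rfl | rfl
    · simp [hst]
    · simp [hst, hst.not_gt]

theorem gridIndex_le_iff {a t : ℝ} (ha : a ∈ Z) : gridIndex Z a ≤ gridIndex Z t ↔ a ≤ t := by
  refine ⟨fun h => ?_, fun h => gridIndex_mono h⟩
  by_contra hlt
  exact absurd (gridIndex_lt ha (not_le.1 hlt) (Or.inr rfl)) (not_lt.2 h)

theorem gridIndex_le_iff' {a t : ℝ} (ha : a ∈ Z) : gridIndex Z t ≤ gridIndex Z a ↔ t ≤ a := by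
  refine ⟨fun h => ?_, fun h => gridIndex_mono h⟩
  by_contra hlt
  exact absurd (gridIndex_lt ha (not_le.1 hlt) (Or.inl rfl)) (not_lt.2 h)

theorem exists_gridIndex_eq_card (Z : Finset ℝ) : ∃ t, gridIndex Z t = Z.card := by
  obtain ⟨b, hb⟩ := Z.bddAbove
  refine ⟨b + 1, ?_⟩
  rw [gridIndex, Finset.card_eq_sum_ones, Nat.cast_sum]
  refine Finset.sum_congr rfl fun a ha => ?_
  have : a ≤ b := hb ha
  rw [if_pos (by linarith)]
  simp

theorem exists_gridIndex_eq_neg_card (Z : Finset ℝ) : ∃ t, gridIndex Z t = -Z.card := by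
  obtain ⟨b, hb⟩ := Z.bddBelow
  refine ⟨b - 1, ?_⟩
  rw [gridIndex, Finset.card_eq_sum_ones, Nat.cast_sum, ← Finset.sum_neg_distrib]
  refine Finset.sum_congr rfl fun a ha => ?_
  have : b ≤ a := hb ha
  rw [if_neg (by linarith), if_pos (by linarith)]
  simp

theorem abs_gridIndex_lt {a : ℝ} (ha : a ∈ Z) : |gridIndex Z a| < Z.card := by
  refine (Finset.abs_sum_le_sum_abs _ _).trans_lt ?_
  rw [Finset.card_eq_sum_ones, Nat.cast_sum]
  refine Finset.sum_lt_sum (fun b _ => ?_) ⟨a, ha, by simp⟩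
  split_ifs <;> simp

/-- The grid index changes by at most one near any point. -/
theorem eventually_gridIndex_near (t : ℝ) :
    ∀ᶠ u in 𝓝 t, |gridIndex Z u - gridIndex Z t| ≤ 1 := by
  have h : ∀ a ∈ Z, ∀ᶠ u in 𝓝 t, a = t ∨ ((a < u ↔ a < t) ∧ (u < a ↔ t < a)) := by
    intro a _
    rcases lt_trichotomy a t with hlt | rfl | hlt
    · filter_upwards [lt_mem_nhds hlt] with u hu
      exact Or.inr ⟨⟨fun _ => hlt, fun _ => hu⟩, ⟨fun h => (hu.not_gt h).elim,
        fun h => (hlt.not_gt h).elim⟩⟩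
    · exact Filter.Eventually.of_forall fun _ => Or.inl rfl
    · filter_upwards [gt_mem_nhds hlt] with u hu
      exact Or.inr ⟨⟨fun h => (hu.not_gt h).elim, fun h => (hlt.not_gt h).elim⟩,
        ⟨fun _ => hlt, fun _ => hu⟩⟩
  filter_upwards [(Filter.eventually_all_finset Z).2 h] with u hu
  rw [gridIndex, gridIndex, ← Finset.sum_sub_distrib]
  by_cases ht : t ∈ Z
  · rw [Finset.sum_eq_single t]
    · simp only [lt_irrefl, if_false]
      split_ifs <;> simp
    · intro b hb hbt
      rcases hu b hb with h | ⟨h1, h2⟩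
      · exact (hbt h).elim
      · simp only [h1, h2, sub_self]
    · exact fun h => (h ht).elim
  · rw [Finset.sum_eq_zero]
    · simp
    · intro b hb
      rcases hu b hb with rfl | ⟨h1, h2⟩
      · exact (ht hb).elim
      · simp only [h1, h2, sub_self]

/-- The grid index has the intermediate value property, as it never jumps by more than one. -/
theorem exists_gridIndex_eq {s t : ℝ} (hst : s ≤ t) {k : ℤ} (h1 : gridIndex Z s ≤ k)
    (h2 : k ≤ gridIndex Z t) : ∃ u ∈ Set.Icc s t, gridIndex Z u = k := by
  by_contra hcon
  push Not at hcon
  have := (isPreconnected_Icc (a := s) (b := t)).iff_of_locally (p := fun u => gridIndex Z u < k)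
    (fun u hu => by
      filter_upwards [nhdsWithin_le_nhds (eventually_gridIndex_near (Z := Z) u),
        self_mem_nhdsWithin] with w hw hw'
      have e1 := hcon u hu
      have e2 := hcon w hw'
      rw [abs_le] at hw
      omega) ⟨le_rfl, hst⟩ ⟨hst, le_rfl⟩
  have e1 := hcon s ⟨le_rfl, hst⟩
  omega

theorem exists_gridIndex_eq_of_abs_le {k : ℤ} (hk : |k| ≤ Z.card) : ∃ u, gridIndex Z u = k := by
  obtain ⟨s, hs⟩ := exists_gridIndex_eq_neg_card Z
  obtain ⟨t, ht⟩ := exists_gridIndex_eq_card Z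
  rw [abs_le] at hk
  rcases le_total s t with h | h
  · obtain ⟨u, -, hu⟩ := exists_gridIndex_eq (Z := Z) h (by omega) (by omega : k ≤ _)
    exact ⟨u, hu⟩
  · have := gridIndex_mono (Z := Z) h
    exact ⟨s, by omega⟩

/-- The lattice cell of a point of the plane. -/
noncomputable def gridCell (Z : Finset ℝ) (z : ℝ × ℝ) : ℤ × ℤ := (gridIndex Z z.1, gridIndex Z z.2)

theorem ordConnected_gridIndex (c : ℤ) : {t | gridIndex Z t = c}.OrdConnected := by
  refine ⟨fun a ha b hb t ht => ?_⟩
  have h1 := gridIndex_mono (Z := Z) ht.1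
  have h2 := gridIndex_mono (Z := Z) ht.2
  simp only [Set.mem_ofPred_eq] at ha hb ⊢
  omega

theorem isPreconnected_gridCell (c : ℤ × ℤ) : IsPreconnected {z | gridCell Z z = c} := by
  have : {z | gridCell Z z = c} = {t | gridIndex Z t = c.1} ×ˢ {t | gridIndex Z t = c.2} := by
    ext z
    simp [gridCell, Prod.ext_iff]
  rw [this]
  exact ((ordConnected_gridIndex _).convex.prod (ordConnected_gridIndex _).convex).isPreconnected

/-- If `P` is a union of cells, then visibility in `P` is visibility between cells. -/
theorem uIcc_subset_iff_boxVisible {P : Set (ℝ × ℝ)} {S : Set (ℤ × ℤ)}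
    (hS : ∀ z, z ∈ P ↔ gridCell Z z ∈ S) (p q : ℝ × ℝ) :
    Set.uIcc p q ⊆ P ↔ BoxVisible S (gridCell Z p) (gridCell Z q) := by
  have hmin := fun a b => (gridIndex_mono (Z := Z)).map_min (a := a) (b := b)
  have hmax := fun a b => (gridIndex_mono (Z := Z)).map_max (a := a) (b := b)
  rw [Set.uIcc_prod_eq]
  constructor
  · intro h x y h1 h2 h3 h4
    simp only [gridCell, ← hmin, ← hmax] at h1 h2 h3 h4
    obtain ⟨u, hu, rfl⟩ := exists_gridIndex_eq min_le_max h1 h2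
    obtain ⟨v, hv, rfl⟩ := exists_gridIndex_eq min_le_max h3 h4
    exact (hS (u, v)).1 (h ⟨hu, hv⟩)
  · rintro h ⟨u, v⟩ ⟨hu, hv⟩
    rw [hS]
    refine h _ _ ?_ ?_ ?_ ?_ <;> simp only [gridCell, ← hmin, ← hmax] <;> apply gridIndex_mono
    exacts [hu.1, hu.2, hv.1, hv.2]

end Grid

namespace SimpleOrthogonalPolygon

variable {n : ℕ} (P : SimpleOrthogonalPolygon n)

open Classical in
/-- All coordinates of the vertices; both axes are subdivided at all of them. -/
noncomputable def coords : Finset ℝ :=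
  have := P.neZero
  Finset.univ.image (fun i => (P.vertex i).1) ∪ Finset.univ.image fun i => (P.vertex i).2

theorem fst_mem_coords (i : ZMod n) : (P.vertex i).1 ∈ P.coords := by
  simp [coords]

theorem snd_mem_coords (i : ZMod n) : (P.vertex i).2 ∈ P.coords := by
  simp [coords]

theorem card_coords_le : P.coords.card ≤ 2 * n := by
  classical
  have := P.neZero
  have hc : (Finset.univ : Finset (ZMod n)).card = n := by rw [Finset.card_univ, ZMod.card]
  refine (Finset.card_union_le _ _).trans ?_
  have h1 := Finset.card_image_le (s := (Finset.univ : Finset (ZMod n)))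
    (f := fun i => (P.vertex i).1)
  have h2 := Finset.card_image_le (s := (Finset.univ : Finset (ZMod n)))
    (f := fun i => (P.vertex i).2)
  rw [hc] at h1 h2
  omega

theorem mem_edge_iff (j : ZMod n) (z : ℝ × ℝ) :
    z ∈ P.edge j ↔ z.1 ∈ Set.uIcc (P.vertex j).1 (P.vertex (j + 1)).1 ∧
      z.2 ∈ Set.uIcc (P.vertex j).2 (P.vertex (j + 1)).2 := by
  unfold edge
  rcases P.horizontal_or_vertical j with h | h
  · rw [mem_segment_horizontal h, ← h, Set.uIcc_self, Set.mem_singleton_iff, and_comm]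
  · rw [mem_segment_vertical h, ← h, Set.uIcc_self, Set.mem_singleton_iff]

/-- The frontier is a union of cells. -/
theorem mem_frontier_of_gridCell_eq {z w : ℝ × ℝ}
    (h : gridCell P.coords z = gridCell P.coords w) (hz : z ∈ frontier P.region) :
    w ∈ frontier P.region := by
  rw [P.frontier_region, Set.mem_iUnion] at hz ⊢
  obtain ⟨j, hj⟩ := hz
  refine ⟨j, ?_⟩
  have key : ∀ {a b s t : ℝ}, a ∈ P.coords → b ∈ P.coords → gridIndex P.coords s =
      gridIndex P.coords t → s ∈ Set.uIcc a b → t ∈ Set.uIcc a b := by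
    intro a b s t ha hb hst hs
    rw [Set.mem_uIcc] at hs ⊢
    rw [← gridIndex_le_iff ha, ← gridIndex_le_iff hb, ← gridIndex_le_iff' ha,
      ← gridIndex_le_iff' hb] at hs ⊢
    rwa [← hst]
  have h' := Prod.ext_iff.1 h
  have hj' := (P.mem_edge_iff j z).1 hj
  exact (P.mem_edge_iff j w).2 ⟨key (P.fst_mem_coords _) (P.fst_mem_coords _) h'.1 hj'.1,
    key (P.snd_mem_coords _) (P.snd_mem_coords _) h'.2 hj'.2⟩

/-- The region is a union of cells. -/
theorem mem_region_of_gridCell_eq {z w : ℝ × ℝ}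
    (h : gridCell P.coords z = gridCell P.coords w) (hz : z ∈ P.region) : w ∈ P.region := by
  have hcl := P.isCompact_region.isClosed
  by_cases hex : ∃ v, gridCell P.coords v = gridCell P.coords w ∧ v ∈ frontier P.region
  · obtain ⟨v, hv, hv'⟩ := hex
    exact hcl.frontier_subset (P.mem_frontier_of_gridCell_eq hv hv')
  · push Not at hex
    rcases (isPreconnected_gridCell (gridCell P.coords w)).subset_or_subset_compl
      (fun v hv => hex v hv) hcl with h' | h'
    · exact h' rfl
    · exact (h' h hz).elim

theorem abs_gridIndex_lt_of_mem {z : ℝ × ℝ} (hz : z ∈ P.region) :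
    |gridIndex P.coords z.1| < P.coords.card ∧ |gridIndex P.coords z.2| < P.coords.card := by
  have hcl := P.isCompact_region.isClosed
  have huIcc : ∀ {a b t : ℝ}, a ∈ P.coords → b ∈ P.coords → t ∈ Set.uIcc a b →
      |gridIndex P.coords t| < P.coords.card := by
    intro a b t ha hb ht
    have h1 := abs_lt.1 (abs_gridIndex_lt ha)
    have h2 := abs_lt.1 (abs_gridIndex_lt hb)
    rw [abs_lt]
    rcases Set.mem_uIcc.1 ht with h | h
    · have e1 := gridIndex_mono (Z := P.coords) h.1
      have e2 := gridIndex_mono (Z := P.coords) h.2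
      omega
    · have e1 := gridIndex_mono (Z := P.coords) h.1
      have e2 := gridIndex_mono (Z := P.coords) h.2
      omega
  have hfr : ∀ w ∈ frontier P.region,
      |gridIndex P.coords w.1| < P.coords.card ∧ |gridIndex P.coords w.2| < P.coords.card := by
    intro w hw
    rw [P.frontier_region, Set.mem_iUnion] at hw
    obtain ⟨j, hj⟩ := hw
    have hj' := (P.mem_edge_iff j w).1 hj
    exact ⟨huIcc (P.fst_mem_coords _) (P.fst_mem_coords _) hj'.1,
      huIcc (P.snd_mem_coords _) (P.snd_mem_coords _) hj'.2⟩
  obtain ⟨R, hR⟩ := P.isCompact_region.isBounded.subset_closedBall 0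
  have hbd : ∀ w ∈ P.region, |w.1| ≤ R ∧ |w.2| ≤ R := by
    intro w hw
    have := hR hw
    rw [mem_closedBall_zero_iff, Prod.norm_def, max_le_iff] at this
    exact this
  -- otherwise the whole line through `z` misses the frontier, and the region is unbounded
  constructor
  · by_contra hcon
    have hline : IsPreconnected ({z.1} ×ˢ Set.univ : Set (ℝ × ℝ)) :=
      isPreconnected_singleton.prod isPreconnected_univ
    have hmiss : ∀ v ∈ ({z.1} ×ˢ Set.univ : Set (ℝ × ℝ)), v ∉ frontier P.region := by
      intro v hv hv'
      apply hcon
      rw [← Set.mem_singleton_iff.1 hv.1]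
      exact (hfr v hv').1
    rcases hline.subset_or_subset_compl hmiss hcl with h | h
    · have := hbd (z.1, R + 1) (h ⟨rfl, trivial⟩)
      have := (le_abs_self _).trans this.2
      linarith
    · exact h ⟨rfl, trivial⟩ hz
  · by_contra hcon
    have hline : IsPreconnected (Set.univ ×ˢ {z.2} : Set (ℝ × ℝ)) :=
      isPreconnected_univ.prod isPreconnected_singleton
    have hmiss : ∀ v ∈ (Set.univ ×ˢ {z.2} : Set (ℝ × ℝ)), v ∉ frontier P.region := by
      intro v hv hv'
      apply hcon
      rw [← Set.mem_singleton_iff.1 hv.2]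
      exact (hfr v hv').2
    rcases hline.subset_or_subset_compl hmiss hcl with h | h
    · have := hbd (R + 1, z.2) (h ⟨trivial, rfl⟩)
      have := (le_abs_self _).trans this.1
      linarith
    · exact h ⟨trivial, rfl⟩ hz

/-- The lattice cells of the points of the region. -/
def cells : Set (ℤ × ℤ) := gridCell P.coords '' P.region

theorem mem_region_iff (z : ℝ × ℝ) : z ∈ P.region ↔ gridCell P.coords z ∈ P.cells := by
  refine ⟨fun h => ⟨z, h, rfl⟩, ?_⟩
  rintro ⟨w, hw, h⟩
  exact P.mem_region_of_gridCell_eq h hw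

theorem cells_subset : P.cells ⊆
    (Finset.Icc (-(P.coords.card : ℤ)) P.coords.card ×ˢ
      Finset.Icc (-(P.coords.card : ℤ)) P.coords.card : Finset (ℤ × ℤ)) := by
  rintro c ⟨z, hz, rfl⟩
  have := P.abs_gridIndex_lt_of_mem hz
  rw [abs_lt, abs_lt] at this
  simp only [gridCell, Finset.coe_product, Set.mem_prod, Finset.coe_Icc, Set.mem_Icc]
  omega

theorem finite_cells : P.cells.Finite := (Finset.finite_toSet _).subset P.cells_subset

theorem ncard_cells_le : P.cells.ncard ≤ (4 * n + 1) ^ 2 := by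
  refine (Set.ncard_le_ncard P.cells_subset (Finset.finite_toSet _)).trans ?_
  rw [Set.ncard_coe_finset, Finset.card_product, Int.card_Icc, ← sq]
  have := P.card_coords_le
  exact Nat.pow_le_pow_left (by omega) 2

theorem coConnected_cells : CoConnected P.cells := by
  refine ⟨P.coords.card, ?_, ?_⟩
  · rintro x y ⟨z, hz, h⟩
    have := P.abs_gridIndex_lt_of_mem hz
    rw [gridCell, Prod.mk.injEq] at h
    rwa [h.1, h.2] at this
  intro Q hQv hQh hQ a b hab
  by_cases hout : (P.coords.card : ℤ) ≤ |a| ∨ (P.coords.card : ℤ) ≤ |b|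
  · exact hQ a b hout
  push Not at hout
  obtain ⟨u, rfl⟩ := exists_gridIndex_eq_of_abs_le hout.1.le
  obtain ⟨v, rfl⟩ := exists_gridIndex_eq_of_abs_le hout.2.le
  obtain ⟨t, ht⟩ := exists_gridIndex_eq_card P.coords
  have hfar : (t, t) ∉ P.region := by
    intro h
    have := (P.abs_gridIndex_lt_of_mem h).1
    rw [ht] at this
    exact absurd this (not_lt.2 (le_abs_self _))
  have hstepv : ∀ a b b', |b' - b| ≤ 1 → (a, b) ∉ P.cells → (a, b') ∉ P.cells →
      (Q a b' ↔ Q a b) := by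
    intro a b b' h h1 h2
    rw [abs_le] at h
    rcases (show b' = b ∨ b' = b + 1 ∨ b = b' + 1 by omega) with rfl | rfl | rfl
    · rfl
    · exact (hQv _ _ h1 h2).symm
    · exact hQv _ _ h2 h1
  have hsteph : ∀ a a' b, |a' - a| ≤ 1 → (a, b) ∉ P.cells → (a', b) ∉ P.cells →
      (Q a' b ↔ Q a b) := by
    intro a a' b h h1 h2
    rw [abs_le] at h
    rcases (show a' = a ∨ a' = a + 1 ∨ a = a' + 1 by omega) with rfl | rfl | rfl
    · rfl
    · exact (hQh _ _ h1 h2).symm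
    · exact hQh _ _ h2 h1
  have hQfar : Q (gridIndex P.coords t) (gridIndex P.coords t) :=
    hQ _ _ (Or.inl (by rw [ht]; exact le_abs_self _))
  have hcell : ∀ z : ℝ × ℝ, z ∉ P.region →
      (gridIndex P.coords z.1, gridIndex P.coords z.2) ∉ P.cells := fun z hz h =>
    hz ((P.mem_region_iff z).2 h)
  have hconst := P.isPreconnected_compl.iff_of_locally
    (p := fun z => Q (gridIndex P.coords z.1) (gridIndex P.coords z.2)) (fun z hz => ?_)
    (x := (u, v)) (y := (t, t)) (fun h => hab ((P.mem_region_iff (u, v)).1 h)) hfar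
  · exact hconst.2 hQfar
  refine nhdsWithin_le_nhds ?_
  -- pass from the cell of `z` to that of a nearby point by changing one coordinate at a time
  have hopen : ∀ᶠ w in 𝓝 z, w ∉ P.region :=
    P.isCompact_region.isClosed.isOpen_compl.mem_nhds hz
  have hmix : Filter.Tendsto (fun w : ℝ × ℝ => (w.1, z.2)) (𝓝 z) (𝓝 z) :=
    (by fun_prop : Continuous fun w : ℝ × ℝ => (w.1, z.2)).tendsto z
  filter_upwards [hopen, hmix.eventually hopen,
    (continuous_fst.tendsto z).eventually (eventually_gridIndex_near (Z := P.coords) z.1),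
    (continuous_snd.tendsto z).eventually (eventually_gridIndex_near (Z := P.coords) z.2)]
    with w h1 h2 h3 h4
  exact (hstepv _ _ _ h4 (hcell (w.1, z.2) h2) (hcell w h1)).trans
    (hsteph _ _ _ h3 (hcell z hz) (hcell (w.1, z.2) h2))

/-- A discrete guarding of the cells gives a guarding of the region. -/
theorem cfRChromaticNumber_le {t : ℕ} (h : ConflictFreeGuardable P.cells P.cells t) :
    cfRChromaticNumber P.region ≤ t := by
  classical
  obtain ⟨G, γ, hG, hγ, hcf⟩ := h
  have hrep : ∀ c, ∃ z, c ∈ P.cells → z ∈ P.region ∧ gridCell P.coords z = c := by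
    intro c
    by_cases hc : c ∈ P.cells
    · obtain ⟨z, hz⟩ := hc
      exact ⟨z, fun _ => hz⟩
    · exact ⟨0, fun h => (hc h).elim⟩
  choose rep hrep using hrep
  have hcell : ∀ g ∈ G, gridCell P.coords (rep g) = g := fun g hg => (hrep g (hG g hg)).2
  have hvis : ∀ p, ∀ g ∈ G, (rep g ∈ rVisibilityRegion P.region p ↔
      BoxVisible P.cells (gridCell P.coords p) g) := by
    intro p g hg
    have := uIcc_subset_iff_boxVisible P.mem_region_iff p (rep g)
    rw [hcell g hg] at this
    rw [← this]
    exact ⟨fun h => h.2, fun h => ⟨(hrep g (hG g hg)).1, h⟩⟩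
  have hmemG : ∀ g ∈ G.image rep, gridCell P.coords g ∈ G ∧ rep (gridCell P.coords g) = g := by
    intro g hg
    obtain ⟨c, hc, rfl⟩ := Finset.mem_image.1 hg
    rw [hcell c hc]
    exact ⟨hc, rfl⟩
  have hunique : ∀ p ∈ P.region, ∃ g : {g // g ∈ G.image rep},
      g.1 ∈ rVisibilityRegion P.region p ∧
      ∀ g' : {g // g ∈ G.image rep}, g'.1 ∈ rVisibilityRegion P.region p →
        γ (gridCell P.coords g'.1) = γ (gridCell P.coords g.1) → g' = g := by
    intro p hp
    obtain ⟨g, hg, hv, hu⟩ := hcf _ ((P.mem_region_iff p).1 hp)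
    refine ⟨⟨rep g, Finset.mem_image_of_mem _ hg⟩, (hvis p g hg).2 hv, fun g' hv' hc => ?_⟩
    obtain ⟨h1, h2⟩ := hmemG g'.1 g'.2
    rw [← h2, hvis p _ h1] at hv'
    rw [hcell g hg] at hc
    have := hu _ h1 hv' hc
    exact Subtype.ext (by rw [← h2, this])
  refine iInf₂_le t ⟨G.image rep, fun g => ⟨γ (gridCell P.coords g.1), hγ _ (hmemG g.1 g.2).1⟩,
    ⟨?_, ?_⟩, ?_⟩
  · intro g hg
    obtain ⟨c, hc, rfl⟩ := Finset.mem_image.1 hg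
    exact (hrep c (hG c hc)).1
  · refine Set.Subset.antisymm (Set.iUnion₂_subset fun g _ q hq => hq.1) fun p hp => ?_
    obtain ⟨g, hg, -⟩ := hunique p hp
    exact Set.mem_biUnion g.2 ⟨hp, by rw [Set.uIcc_comm]; exact hg.2⟩
  · intro p hp
    obtain ⟨g, hg, hu⟩ := hunique p hp
    exact ⟨g, hg, fun g' hg' hc => hu g' hg' (Fin.mk.inj_iff.1 hc)⟩

end SimpleOrthogonalPolygon

/-! ### The number of colors -/

theorem natLog_two_le {m : ℕ} {b : ℝ} (hm : (m : ℝ) ≤ b) (hb : 1 ≤ b) :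
    (Nat.log 2 m : ℝ) ≤ 2 * Real.log b := by
  rcases Nat.eq_zero_or_pos m with rfl | hpos
  · simpa using Real.log_nonneg hb
  have h1 : ((2 : ℝ) ^ Nat.log 2 m) ≤ b := by
    refine le_trans ?_ hm
    exact_mod_cast Nat.pow_log_le_self 2 hpos.ne'
  have h2 := Real.log_le_log (by positivity) h1
  rw [Real.log_pow] at h2
  have h3 : (1 : ℝ) / 2 ≤ Real.log 2 := by linarith [Real.log_two_gt_d9]
  have h4 : (0 : ℝ) ≤ Nat.log 2 m := Nat.cast_nonneg _
  nlinarith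

theorem color_bound {n m : ℕ} (hn : 4 ≤ n) (hm : m ≤ (4 * n + 1) ^ 2) :
    ((8 * (Nat.log 2 (Nat.log 2 m + 1) + 1) : ℕ) : ℝ) ≤ 240 * Real.log (Real.log n) := by
  have hn' : (4 : ℝ) ≤ n := by exact_mod_cast hn
  have hlog4 : (1.38 : ℝ) ≤ Real.log 4 := by
    have : Real.log 4 = 2 * Real.log 2 := by
      rw [show (4 : ℝ) = 2 ^ 2 by norm_num, Real.log_pow]
      norm_num
    linarith [Real.log_two_gt_d9]
  have hL : (1.38 : ℝ) ≤ Real.log n := hlog4.trans (Real.log_le_log (by norm_num) hn')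
  set L := Real.log n with hLdef
  have hLL : (1 / 4 : ℝ) ≤ Real.log L := by
    have h1 := Real.one_sub_inv_le_log_of_pos (show 0 < L by linarith)
    have h2 : L⁻¹ ≤ (1.38 : ℝ)⁻¹ := inv_anti₀ (by norm_num) hL
    norm_num at h2
    linarith
  have hm6 : (m : ℝ) ≤ (n : ℝ) ^ 6 := by
    have h1 : (m : ℝ) ≤ (4 * n + 1) ^ 2 := by exact_mod_cast hm
    have h2 : (4 * n + 1 : ℝ) ≤ (n : ℝ) ^ 3 := by nlinarith [mul_self_nonneg ((n : ℝ) - 4)]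
    calc (m : ℝ) ≤ (4 * n + 1) ^ 2 := h1
      _ ≤ ((n : ℝ) ^ 3) ^ 2 := by gcongr
      _ = (n : ℝ) ^ 6 := by ring
  have h1 : (Nat.log 2 m : ℝ) ≤ 12 * L := by
    have := natLog_two_le hm6 (one_le_pow₀ (by linarith))
    rw [Real.log_pow] at this
    push_cast at this
    linarith
  have h2 : (Nat.log 2 (Nat.log 2 m + 1) : ℝ) ≤ 2 * Real.log (13 * L) := by
    refine natLog_two_le ?_ (by linarith)
    push_cast
    linarith
  have h3 : Real.log (13 * L) ≤ 3 + Real.log L := by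
    rw [Real.log_mul (by norm_num) (by linarith)]
    have : Real.log 13 ≤ 3 := by
      have h16 : Real.log 13 ≤ Real.log 16 := Real.log_le_log (by norm_num) (by norm_num)
      have : Real.log 16 = 4 * Real.log 2 := by
        rw [show (16 : ℝ) = 2 ^ 4 by norm_num, Real.log_pow]
        norm_num
      linarith [Real.log_two_lt_d9]
    linarith
  push_cast
  linarith

theorem mainTheorem3 :
    ∃ C : ℝ, ∀ (n : ℕ) (P : SimpleOrthogonalPolygon n),
      ∃ t : ℕ, cfRChromaticNumber P.region ≤ (t : ℕ∞) ∧
        (t : ℝ) ≤ C * Real.log (Real.log (n : ℝ)) :=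
  ⟨240, fun _ P => ⟨_, P.cfRChromaticNumber_le (P.coConnected_cells.guardable P.finite_cells),
    color_bound P.four_le P.ncard_cells_le⟩⟩
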